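/- **Long finite sequences.** For a word $s=s_1s_2\cdots s_N$ and $1\le i\le N/2$ put $s^{(i)}=s_is_{i+1}\cdots s_{2i}$. The word $s$ has property $(*)$ if there are no $1\le i<j\le N/2$ such that $s^{(i)}$ is a subword (a not necessarily contiguous subsequence) of $s^{(j)}$. For $k\ge 1$ let $n(k)$ be the length of a longest word with property $(*)$ over an alphabet of $k$ letters; this maximum exists. **Turing machines.** A $\mathrm{TM}(n,m)$ is a deterministic machine with one tape, infinite in both directions, with $n$ states (the halting state HALT is not counted) and $m$ tape symbols (the blank is counted). In one step it reads the scanned symbol, writes a symbol, moves its head one cell to the left or to the right, and enters a new state or HALT, as determined by the current state and the scanned symbol; the step that enters HALT is counted. The machine *computes* the number $v$ if, started on the empty (all blank) tape, it runs for more than $v$ steps and then halts, with $v$ shown in unary on its final tape: somewhere on the tape there are exactly $v+1$ consecutive copies of a stroke, neither preceded nor followed by a further copy, where a stroke is some fixed word of tape symbols, not all of them blank (a single symbol, or the code word of a symbol). **Theorem.** For each of the following sizes there is a Turing machine of that size that computes $n(3)$, respectively $n(4)$; in particular it halts on the empty tape after more than $n(3)$, respectively $n(4)$, steps. * For $n(3)$: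 $\mathrm{TM}(2,1840)$, $\mathrm{TM}(3,1080)$, $\mathrm{TM}(9,800)$, $\mathrm{TM}(44,8)$, $\mathrm{TM}(54,7)$, $\mathrm{TM}(155,3)$ and $\mathrm{TM}(276,2)$. * For $n(4)$: $\mathrm{TM}(2,2450)$, $\mathrm{TM}(3,1440)$, $\mathrm{TM}(9,1030)$, $\mathrm{TM}(47,10)$, $\mathrm{TM}(58,9)$, $\mathrm{TM}(160,4)$, $\mathrm{TM}(353,3)$ and $\mathrm{TM}(922,2)$. -/

import Mathlib

/-! ### Long finite sequences -/

namespace Friedman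

/-- For a word `s = s₁ s₂ ⋯` and `1 ≤ i`, the word `s⁽ⁱ⁾ = sᵢ sᵢ₊₁ ⋯ s₂ᵢ` of length `i + 1`
(for `2 * i ≤ s.length`). -/
def block {α : Type*} (s : List α) (i : ℕ) : List α :=
  (s.drop (i - 1)).take (i + 1)

/-- Property `(*)`: there are no `1 ≤ i < j ≤ s.length / 2` such that `s⁽ⁱ⁾` is a subword of `s⁽ʲ⁾`.
A subword is a not necessarily contiguous one, which is `List.Sublist`. -/
def Star {α : Type*} (s : List α) : Prop :=
  ∀ i j : ℕ, 1 ≤ i → i < j → 2 * j ≤ s.length → ¬ (block s i).Sublist (block s j)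

/-- The lengths of the words with property `(*)` over an alphabet of `k` letters. -/
def starLengths (k : ℕ) : Set ℕ :=
  {N | ∃ s : List (Fin k), s.length = N ∧ Star s}

/-- `n(k)`, the length of a longest word with property `(*)` over an alphabet of `k` letters. The
maximum exists, see `isGreatest_longest`. -/
noncomputable def longest (k : ℕ) : ℕ := sSup (starLengths k)

theorem block_congr {α : Type*} {s t : List α} {i : ℕ} (hi : 1 ≤ i) (hs : 2 * i ≤ s.length)
    (ht : 2 * i ≤ t.length) (h : ∀ m (h₁ : m < s.length) (h₂ : m < t.length), m < 2 * i →
      s[m] = t[m]) : block s i = block t i := by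
  unfold block
  apply List.ext_getElem
  · simp; omega
  · intro m h₁ h₂
    simp only [List.length_take, List.length_drop] at h₁ h₂
    simp only [List.getElem_take, List.getElem_drop]
    apply h
    omega

theorem bddAbove_starLengths (k : ℕ) : BddAbove (starLengths k) := by
  by_contra hb
  rw [not_bddAbove_iff] at hb
  let C : ℕ → Set (ℕ → Fin k) := fun n => {f | Star (List.ofFn fun i : Fin n => f i)}
  have hanti : ∀ n, C (n + 1) ⊆ C n := by
    intro n f hf i j hi hij hj hsub
    simp only [List.length_ofFn] at hj
    refine hf i j hi hij (by simp; omega) ?_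
    rw [block_congr (t := List.ofFn fun i : Fin n => f i) hi (by simp; omega) (by simp; omega)
      (by intros; simp only [List.getElem_ofFn]), block_congr (i := j) (t := List.ofFn fun i : Fin n => f i) (by omega)
      (by simp; omega) (by simp; omega) (by intros; simp only [List.getElem_ofFn])]
    exact hsub
  have hne : ∀ n, (C n).Nonempty := by
    intro n
    obtain ⟨N, ⟨s, hs, hstar⟩, hN⟩ := hb n
    have hpos : 0 < s.length := by omega
    refine ⟨fun i => s.getD i s[0], ?_⟩
    intro i j hi hij hj hsub
    simp only [List.length_ofFn] at hj
    refine hstar i j hi hij (by omega) ?_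
    rw [block_congr (t := List.ofFn fun i : Fin n => s.getD i s[0]) hi (by omega) (by simp; omega)
      (by intro m h₁ h₂ _; simp [h₁]),
      block_congr (i := j) (t := List.ofFn fun i : Fin n => s.getD i s[0]) (by omega)
      (by omega) (by simp; omega) (by intro m h₁ h₂ _; simp [h₁])]
    exact hsub
  have hclosed : ∀ n, IsClosed (C n) := by
    intro n
    have hc : Continuous fun (f : ℕ → Fin k) (i : Fin n) => f i := by fun_prop
    exact (isClosed_discrete {g : Fin n → Fin k | Star (List.ofFn g)}).preimage hc
  obtain ⟨f, hf⟩ := IsCompact.nonempty_iInter_of_sequence_nonempty_isCompact_isClosed C hanti hne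
    (hclosed 0).isCompact hclosed
  rw [Set.mem_iInter] at hf
  have hfin : (Set.univ : Set (Fin k)).PartiallyWellOrderedOn Eq :=
    Set.finite_univ.partiallyWellOrderedOn
  have hig := hfin.partiallyWellOrderedOn_sublistForall₂ Eq
  let g : ℕ → List (Fin k) := fun i => block (List.ofFn fun m : Fin (2 * (i + 1)) => f m) (i + 1)
  obtain ⟨i, j, hij, hsub⟩ := hig.exists_lt (f := g) (by simp)
  rw [List.sublistForall₂_iff] at hsub
  obtain ⟨l, hl, hsub⟩ := hsub
  rw [List.forall₂_eq_eq_eq] at hl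
  subst hl
  refine hf (2 * (j + 1)) (i + 1) (j + 1) (by omega) (by omega) (by rw [List.length_ofFn]) ?_
  rw [block_congr (t := List.ofFn fun m : Fin (2 * (i + 1)) => f m) (by omega)
    (by rw [List.length_ofFn]; omega) (by rw [List.length_ofFn])
    (by intros; simp only [List.getElem_ofFn])]
  exact hsub

theorem isGreatest_longest (k : ℕ) : IsGreatest (starLengths k) (longest k) :=
  have hne : (starLengths k).Nonempty := ⟨0, [], rfl, fun i j _ _ h => by simp at h; omega⟩
  ⟨Nat.sSup_mem hne (bddAbove_starLengths k), fun _ h => le_csSup (bddAbove_starLengths k) h⟩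

end Friedman

/-! ### Turing machines -/

/-- A Turing machine with `n` states and `m` tape symbols, one of them the blank. In state `q`,
scanning the symbol `e`, it writes the symbol `write q e`, moves its head one cell in the direction
`move q e`, and enters the state `next q e`, where `none` stands for HALT (which is not counted as
one of the `n` states). -/
structure TM (n m : ℕ) where
  start : Fin n
  blank : Fin m
  next : Fin n → Fin m → Option (Fin n)
  write : Fin n → Fin m → Fin m
  move : Fin n → Fin m → Turing.Dir

namespace TM

/-- A configuration: the state (`none` after halting), the head position, and the content of the
tape, which is infinite in both directions. -/
structure Config (n m : ℕ) where
  state : Option (Fin n)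
  head : ℤ
  tape : ℤ → Fin m

/-- The displacement of the head. -/
def shift : Turing.Dir → ℤ
  | Turing.Dir.left => -1
  | Turing.Dir.right => 1

/-- One step of the machine; a halted configuration stays as it is. -/
def step {n m : ℕ} (M : TM n m) (c : Config n m) : Config n m :=
  match c.state with
  | none => c
  | some q =>
    { state := M.next q (c.tape c.head)
      head := c.head + shift (M.move q (c.tape c.head))
      tape := Function.update c.tape c.head (M.write q (c.tape c.head)) }

/-- The start state on an empty tape. -/
def init {n m : ℕ} (M : TM n m) : Config n m :=
  { state := some M.start, head := 0, tape := fun _ => M.blank }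

/-- The configuration after `t` steps from the empty tape. -/
def run {n m : ℕ} (M : TM n m) (t : ℕ) : Config n m := M.step^[t] M.init

/-- Started on an empty tape, the machine makes exactly `T` steps and then has halted. The step
that enters HALT is counted. -/
def HaltsAfter {n m : ℕ} (M : TM n m) (T : ℕ) : Prop :=
  (M.run T).state = none ∧ ∀ t < T, (M.run t).state ≠ none

/-- The word `w` stands on the tape, from cell `p` on rightwards. -/
def Reads {m l : ℕ} (tape : ℤ → Fin m) (p : ℤ) (w : Fin l → Fin m) : Prop :=
  ∀ i : Fin l, tape (p + (i : ℕ)) = w i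

/-- The tape shows the number `v` in unary, by `v + 1` strokes: somewhere on the tape there is a
sequence of exactly `v + 1` consecutive copies of a stroke `w`, neither preceded nor followed by a
further copy. The stroke is a fixed word, not entirely blank, of some length `l ≥ 1` (which is `1`
when strokes are single symbols, and larger when symbols are coded by words over a smaller
alphabet). -/
def ShowsUnary {m : ℕ} (blank : Fin m) (tape : ℤ → Fin m) (v : ℕ) : Prop :=
  ∃ (l : ℕ) (w : Fin l → Fin m) (p : ℤ), (∃ i, w i ≠ blank) ∧
    (∀ j : ℕ, j ≤ v → Reads tape (p + l * j) w) ∧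
    ¬ Reads tape (p - l) w ∧ ¬ Reads tape (p + l * (v + 1)) w

/-- Started on an empty tape, the machine runs for more than `v` steps and then halts, with `v`
shown in unary on its tape. -/
def Computes {n m : ℕ} (M : TM n m) (v : ℕ) : Prop :=
  ∃ T : ℕ, v < T ∧ M.HaltsAfter T ∧ ShowsUnary M.blank (M.run T).tape v

/-- There is a machine with `n` states and `m` symbols that computes `v`. -/
def ExistsOfSize (n m v : ℕ) : Prop := ∃ M : TM n m, M.Computes v

end TM

/-! A single search machine over `k = K + 1` letters carries the result; everything else makes it
small. It runs through the words of the current length in lexicographic order and tests each for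
property `(*)`. A good word gets a letter `0` appended, a bad one is replaced by its successor. The
search skips no good word: a word below `w0` has a good prefix below `w` if it is good itself, and
those were already excluded. Hence it overflows exactly when no word of the current length is good.
As prefixes of good words are good, this happens at length `n(k) + 1`. The overflow has just written
zeros everywhere, so the tape then shows `n(k) + 1` equal symbols, the required unary output
(`Searcher.reaches_halt`, `Searcher.outputs_longest`).

The test compares a pattern block with a text block by greedy subsequence matching. Marks on the
letters delimit the two blocks and record what has been consumed (`reaches_match`, `reaches_pairs`,
`reaches_patterns`).

To trade symbols for states, each symbol is coded by a word of fixed length over a small alphabet.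
That an explicit transition table simulates the search machine is then a finite check, one local run
for each state and symbol (`Mach.Outputs.computes_of_localStep`). Codes of length 2 give 39 states
with 7 symbols and 42 with 9; codes of six bits give 124 and 141 states with 2 symbols.

To trade states for symbols, Shannon's construction turns the binary machines into machines with two
states: the state is stored in the cells as a counter, and handed to the neighbouring cell in unary
(`TwoState.existsOfSize_two`). All remaining sizes follow by adding unused states and symbols
(`TM.ExistsOfSize.mono`).

No step counts are tracked: a machine needs more than `v` steps to write `v + 1` strokes. -/

/-! ### Machines over arbitrary types of states and symbols -/

/-- A Turing machine whose states and tape symbols are taken from arbitrary types: `trans q e` is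
the next state (`none` for HALT), the symbol written, and the direction of the move. -/
structure Mach (Q S : Type) where
  start : Q
  blank : S
  trans : Q → S → Option Q × S × Turing.Dir

namespace Mach

variable {Q S : Type}

/-- A configuration of a machine. -/
@[ext] structure Cfg (Q S : Type) where
  state : Option Q
  head : ℤ
  tape : ℤ → S

/-- One step; a halted configuration stays as it is. -/
def step (M : Mach Q S) (c : Cfg Q S) : Cfg Q S :=
  match c.state with
  | none => c
  | some q =>
    { state := (M.trans q (c.tape c.head)).1
      head := c.head + TM.shift (M.trans q (c.tape c.head)).2.2
      tape := Function.update c.tape c.head (M.trans q (c.tape c.head)).2.1 }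

/-- The start state on an empty tape. -/
def init (M : Mach Q S) : Cfg Q S := ⟨some M.start, 0, fun _ => M.blank⟩

/-- `c'` is reached from `c` in some number of steps. -/
def Reaches (M : Mach Q S) (c c' : Cfg Q S) : Prop := ∃ t, M.step^[t] c = c'

theorem Reaches.refl (M : Mach Q S) (c : Cfg Q S) : M.Reaches c c := ⟨0, rfl⟩

theorem Reaches.trans {M : Mach Q S} {a b c : Cfg Q S} (h : M.Reaches a b) (h' : M.Reaches b c) :
    M.Reaches a c := by
  obtain ⟨s, rfl⟩ := h
  obtain ⟨t, rfl⟩ := h'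
  exact ⟨t + s, Function.iterate_add_apply _ _ _ _⟩

theorem reaches_step (M : Mach Q S) {q : Q} {h : ℤ} {tape tape' : ℤ → S} {q' : Option Q} {e : S}
    {d : Turing.Dir} (ht : M.trans q (tape h) = (q', e, d))
    (ht' : tape' = Function.update tape h e) :
    M.Reaches ⟨some q, h, tape⟩ ⟨q', h + TM.shift d, tape'⟩ :=
  ⟨1, by simp [step, ht, ht']⟩

/-- A sweep to the right: from `x` up to `y` the machine stays in the state `q`. -/
theorem reaches_sweep_right (M : Mach Q S) {q : Q} {x y : ℤ} {tape tape' : ℤ → S} (hxy : x ≤ y)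
    (hin : ∀ z, x ≤ z → z < y → M.trans q (tape z) = (some q, tape' z, Turing.Dir.right))
    (hout : ∀ z, (z < x ∨ y ≤ z) → tape' z = tape z) :
    M.Reaches ⟨some q, x, tape⟩ ⟨some q, y, tape'⟩ := by
  obtain ⟨n, rfl⟩ : ∃ n : ℕ, y = x + n := ⟨(y - x).toNat, by omega⟩
  clear hxy
  induction n generalizing x tape with
  | zero =>
    have : tape' = tape := by
      funext z
      exact hout z (by push_cast; omega)
    subst this
    simpa using Reaches.refl M _
  | succ n ih =>
    have h1 := M.reaches_step (hin x le_rfl (by push_cast; omega)) rfl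
    refine h1.trans ?_
    have h2 := ih (x := x + 1) (tape := Function.update tape x (tape' x)) ?_ ?_
    · have e : x + 1 + (n : ℤ) = x + ((n + 1 : ℕ) : ℤ) := by push_cast; ring
      rw [e] at h2
      exact h2
    · intro z h1 h2
      rw [Function.update_of_ne (by omega)]
      exact hin z (by omega) (by push_cast; omega)
    · intro z hz
      rcases eq_or_ne z x with rfl | hne
      · simp
      · rw [Function.update_of_ne hne]
        exact hout z (by push_cast; omega)

/-- A sweep to the left: from `x` down to `y` the machine stays in the state `q`. -/
theorem reaches_sweep_left (M : Mach Q S) {q : Q} {x y : ℤ} {tape tape' : ℤ → S} (hxy : y ≤ x)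
    (hin : ∀ z, y < z → z ≤ x → M.trans q (tape z) = (some q, tape' z, Turing.Dir.left))
    (hout : ∀ z, (z ≤ y ∨ x < z) → tape' z = tape z) :
    M.Reaches ⟨some q, x, tape⟩ ⟨some q, y, tape'⟩ := by
  obtain ⟨n, rfl⟩ : ∃ n : ℕ, y = x - n := ⟨(x - y).toNat, by omega⟩
  clear hxy
  induction n generalizing x tape with
  | zero =>
    have : tape' = tape := by
      funext z
      exact hout z (by push_cast; omega)
    subst this
    simpa using Reaches.refl M _
  | succ n ih =>
    have h1 := M.reaches_step (hin x (by push_cast; omega) le_rfl) rfl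
    refine h1.trans ?_
    have h2 := ih (x := x + TM.shift Turing.Dir.left)
      (tape := Function.update tape x (tape' x)) ?_ ?_
    · have e : x + TM.shift Turing.Dir.left - (n : ℤ) = x - ((n + 1 : ℕ) : ℤ) := by
        simp only [TM.shift]; push_cast; ring
      rw [e] at h2
      exact h2
    · intro z h1 h2
      simp only [TM.shift] at h1 h2
      rw [Function.update_of_ne (by omega)]
      exact hin z (by push_cast; omega) (by omega)
    · intro z hz
      simp only [TM.shift] at hz
      rcases eq_or_ne z x with rfl | hne
      · simp
      · rw [Function.update_of_ne hne]
        exact hout z (by push_cast; omega)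

/-- The machine halts on the empty tape, and then shows a block of exactly `v + 1` symbols `e`. -/
def Outputs (M : Mach Q S) (v : ℕ) : Prop :=
  ∃ (e : S) (h p : ℤ) (tape : ℤ → S), e ≠ M.blank ∧ M.Reaches M.init ⟨none, h, tape⟩ ∧
    (∀ j : ℕ, j ≤ v → tape (p + j) = e) ∧ tape (p - 1) ≠ e ∧ tape (p + (v + 1)) ≠ e

end Mach

/-! ### Computing a number -/

namespace TM

variable {n m : ℕ}

theorem iterate_step_of_state_eq_none (M : TM n m) {c : Config n m} (h : c.state = none) (t : ℕ) :
    M.step^[t] c = c := by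
  induction t with
  | zero => rfl
  | succ t ih => rw [Function.iterate_succ_apply, show M.step c = c by simp [step, h], ih]

/-- Each step changes at most one cell. -/
theorem exists_finset_card_le (M : TM n m) (t : ℕ) :
    ∃ s : Finset ℤ, s.card ≤ t ∧ ∀ z ∉ s, (M.run t).tape z = M.blank := by
  induction t with
  | zero => exact ⟨∅, by simp, fun z _ => rfl⟩
  | succ t ih =>
    obtain ⟨s, hs, h⟩ := ih
    refine ⟨insert (M.run t).head s, (Finset.card_insert_le _ _).trans (by omega), ?_⟩
    intro z hz
    rw [Finset.mem_insert, not_or] at hz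
    have : M.run (t + 1) = M.step (M.run t) := Function.iterate_succ_apply' _ _ _
    rw [this, step]
    split
    · exact h z hz.2
    · simp [Function.update_of_ne hz.1, h z hz.2]

/-- A number shown after `t` steps is less than `t`. -/
theorem lt_of_showsUnary (M : TM n m) {t v : ℕ} (h : ShowsUnary M.blank (M.run t).tape v) :
    v < t := by
  obtain ⟨l, w, p, ⟨i, hi⟩, hw, -, -⟩ := h
  obtain ⟨s, hs, hz⟩ := M.exists_finset_card_le t
  -- Position `i` of the stroke is not blank, so the `v + 1` copies provide `v + 1` distinct cells
  -- that must have been written.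
  have hmem : ∀ j ∈ Finset.range (v + 1), p + l * (j : ℕ) + (i : ℕ) ∈ s := by
    intro j hj
    by_contra hn
    exact hi ((hw j (by simpa [Nat.lt_succ_iff] using hj) i).symm.trans (hz _ hn))
  have hinj : Set.InjOn (fun j : ℕ => p + l * (j : ℤ) + (i : ℕ)) (Finset.range (v + 1)) := by
    intro a _ b _ hab
    have hl : (l : ℤ) ≠ 0 := by have := i.2; omega
    have : (l : ℤ) * a = l * b := by simpa using hab
    exact_mod_cast mul_left_cancel₀ hl this
  have := Finset.card_le_card_of_injOn _ hmem hinj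
  simp at this
  omega

/-- A halted configuration is frozen, so the tape at time `t` is the tape at the first halting time,
and the bound on the running time comes from `lt_of_showsUnary`. -/
theorem computes_of_showsUnary (M : TM n m) {t v : ℕ} (ht : (M.run t).state = none)
    (h : ShowsUnary M.blank (M.run t).tape v) : M.Computes v := by
  classical
  have hex : ∃ t, (M.run t).state = none := ⟨t, ht⟩
  have hrun : M.run t = M.run (Nat.find hex) := by
    have hle := Nat.find_min' hex ht
    obtain ⟨s, rfl⟩ := Nat.exists_eq_add_of_le' hle
    rw [run, Function.iterate_add_apply]
    exact M.iterate_step_of_state_eq_none (Nat.find_spec hex) s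
  rw [hrun] at h
  exact ⟨Nat.find hex, M.lt_of_showsUnary h, ⟨Nat.find_spec hex, fun _ h => Nat.find_min hex h⟩, h⟩

/-! ### Simulation by coding each symbol by a word -/

/-- Run `M` in state `q` on the word `ls.reverse ++ a :: rs`, scanning the letter `a`, until it
halts or leaves the word: the new state, the direction of the last move, and the word left. -/
def localRun (M : TM n m) :
    ℕ → Fin n → List (Fin m) → Fin m → List (Fin m) →
      Option (Option (Fin n) × Turing.Dir × List (Fin m))
  | 0, _, _, _, _ => none
  | f + 1, q, ls, a, rs =>
    match M.next q a, M.move q a, ls, rs with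
    | none, d, ls, rs => some (none, d, ls.reverseAux (M.write q a :: rs))
    | some q', Turing.Dir.right, ls, [] =>
      some (some q', Turing.Dir.right, ls.reverseAux [M.write q a])
    | some q', Turing.Dir.right, ls, b :: rs => localRun M f q' (M.write q a :: ls) b rs
    | some q', Turing.Dir.left, [], rs => some (some q', Turing.Dir.left, M.write q a :: rs)
    | some q', Turing.Dir.left, b :: ls, rs => localRun M f q' ls b (M.write q a :: rs)

/-- The tape reads the word `w` from cell `o` on. -/
def Holds (tape : ℤ → Fin m) (o : ℤ) (w : List (Fin m)) : Prop :=
  ∀ i (h : i < w.length), tape (o + i) = w[i]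

theorem Holds.update {tape : ℤ → Fin m} {o : ℤ} {u v : List (Fin m)} {a : Fin m}
    (h : Holds tape o (u ++ a :: v)) (b : Fin m) :
    Holds (Function.update tape (o + u.length) b) o (u ++ b :: v) := by
  intro i hi
  rcases eq_or_ne i u.length with rfl | hne
  · simp
  · rw [Function.update_of_ne (by omega), h i (by simpa using hi)]
    rcases lt_or_gt_of_ne hne with hlt | hlt
    · rw [List.getElem_append_left hlt, List.getElem_append_left hlt]
    · rw [List.getElem_append_right hlt.le, List.getElem_append_right hlt.le]
      obtain ⟨k, hk⟩ : ∃ k, i - u.length = k + 1 := ⟨i - u.length - 1, by omega⟩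
      simp [hk]

/-- Links the computable run inside one word to the run on the infinite tape: until it halts or
exits, the head never leaves the word, so nothing outside is read or changed. After halting the head
position is irrelevant and left open. -/
theorem localRun_spec (M : TM n m) {f : ℕ} {q : Fin n} {ls rs w : List (Fin m)} {a : Fin m}
    {r : Option (Fin n)} {d : Turing.Dir} (h : M.localRun f q ls a rs = some (r, d, w))
    {o x : ℤ} {tape : ℤ → Fin m} (hx : x = o + ls.length)
    (ht : Holds tape o (ls.reverse ++ a :: rs)) :
    ∃ t, ∃ c : Config n m, M.step^[t] ⟨some q, x, tape⟩ = c ∧ c.state = r ∧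
      (r ≠ none → c.head = if d = Turing.Dir.right then o + (ls.length + rs.length + 1 : ℕ)
        else o - 1) ∧
      w.length = ls.length + rs.length + 1 ∧ Holds c.tape o w ∧
      ∀ z, (z < o ∨ o + (ls.length + rs.length + 1 : ℕ) ≤ z) → c.tape z = tape z := by
  induction f generalizing q ls a rs x tape with
  | zero => simp [localRun] at h
  | succ f ih =>
    have ha : tape x = a := by
      have := ht ls.length (by simp)
      rw [hx]
      simpa using this
    have hstep : M.step ⟨some q, x, tape⟩ = ⟨M.next q a, x + shift (M.move q a),
        Function.update tape x (M.write q a)⟩ := by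
      simp [step, ha]
    have hu : Holds (Function.update tape x (M.write q a)) o (ls.reverse ++ M.write q a :: rs) := by
      have := ht.update (M.write q a)
      rwa [List.length_reverse, ← hx] at this
    have hout : ∀ z, (z < o ∨ o + (ls.length + rs.length + 1 : ℕ) ≤ z) →
        Function.update tape x (M.write q a) z = tape z := by
      intro z hz
      rw [Function.update_of_ne]
      push_cast at hz
      omega
    unfold localRun at h
    split at h
    · simp only [Option.some.injEq, Prod.mk.injEq] at h
      obtain ⟨rfl, rfl, rfl⟩ := h
      exact ⟨1, _, hstep, by simpa, by simp, by simp; omega,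
        by simpa [List.reverseAux_eq] using hu, hout⟩
    · rename_i q' hn hd
      simp only [Option.some.injEq, Prod.mk.injEq] at h
      obtain ⟨rfl, rfl, rfl⟩ := h
      refine ⟨1, _, hstep, hn, ?_, by simp, by simpa [List.reverseAux_eq] using hu, hout⟩
      simp [hd, hx, shift]; ring
    · rename_i hn hd
      obtain ⟨t, c, hc, h1, h2, h3, h4, h5⟩ := ih h (x := x + 1) (by simp [hx]; ring)
        (by simpa using hu)
      refine ⟨t + 1, c, ?_, h1, ?_, ?_, h4, ?_⟩
      · rw [Function.iterate_succ_apply, hstep, ← hc, hn, hd]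
        rfl
      · intro hr
        rw [h2 hr]
        simp; split_ifs <;> ring
      · simp [h3]; omega
      · intro z hz
        rw [h5 z (by simp at hz ⊢; omega), hout z hz]
    · rename_i hn hd
      simp only [Option.some.injEq, Prod.mk.injEq] at h
      obtain ⟨rfl, rfl, rfl⟩ := h
      refine ⟨1, _, hstep, hn, ?_, by simp, by simpa using hu, hout⟩
      simp [hd, hx, shift]; ring
    · rename_i hn hd
      obtain ⟨t, c, hc, h1, h2, h3, h4, h5⟩ := ih h (x := x - 1) (by simp [hx]; ring)
        (by simpa using hu)
      refine ⟨t + 1, c, ?_, h1, ?_, ?_, h4, ?_⟩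
      · rw [Function.iterate_succ_apply, hstep, ← hc, hn, hd]
        rfl
      · intro hr
        rw [h2 hr]
        simp; split_ifs <;> ring
      · simp [h3]; omega
      · intro z hz
        rw [h5 z (by simp at hz ⊢; omega), hout z hz]

end TM

namespace Mach

variable {Q S : Type} {n m : ℕ}

/-- The coded machine does one step of `M` in state `q` scanning `e`: it starts at the end of the
code word of `e` where the state `q` enters, and leaves the code word of the new symbol on the side
where the new state enters. -/
def LocalStep (M : Mach Q S) (M' : TM n m) (code : S → List (Fin m)) (enter : Q → Turing.Dir)
    (σ : Q → Fin n) (f : ℕ) (q : Q) (e : S) : Bool :=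
  let r := match enter q with
    | Turing.Dir.right => match code e with
      | [] => none
      | a :: rs => M'.localRun f (σ q) [] a rs
    | Turing.Dir.left => match (code e).reverse with
      | [] => none
      | a :: ls => M'.localRun f (σ q) ls a []
  match r, M.trans q e with
  | some (none, _, w), (none, e', _) => w == code e'
  | some (some p, d, w), (some q', e', d') => p == σ q' && d == d' && enter q' == d' && w == code e'
  | _, _ => false

/-- The tape codes `tape`, the cell `0` starting at `o`. -/
def Codes (l : ℕ) (code : S → List (Fin m)) (o : ℤ) (tape : ℤ → S) (tape' : ℤ → Fin m) : Prop :=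
  ∀ z, TM.Holds tape' (o + l * z) (code (tape z))

/-- The position in a code word of length `l` where it is entered by moves in the direction `d`. -/
def offset (l : ℕ) : Turing.Dir → ℤ
  | Turing.Dir.right => 0
  | Turing.Dir.left => l - 1

theorem Codes.update {l : ℕ} {code : S → List (Fin m)} {o : ℤ} {tape : ℤ → S}
    {t t' : ℤ → Fin m} (hcode : ∀ e, (code e).length = l) (h : Codes l code o tape t) {x : ℤ}
    {e : S} (he : TM.Holds t' (o + l * x) (code e))
    (hout : ∀ z, (z < o + l * x ∨ o + l * x + l ≤ z) → t' z = t z) :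
    Codes l code o (Function.update tape x e) t' := by
  intro z
  rcases eq_or_ne z x with rfl | hne
  · simpa using he
  · rw [Function.update_of_ne hne]
    intro i hi
    rw [hout, h z i hi]
    rw [hcode] at hi
    rcases lt_or_gt_of_ne hne with hlt | hlt
    · left
      have : (l : ℤ) * (z + 1) ≤ l * x := mul_le_mul_of_nonneg_left (by omega) (by omega)
      rw [mul_add] at this
      omega
    · right
      have : (l : ℤ) * (x + 1) ≤ l * z := mul_le_mul_of_nonneg_left (by omega) (by omega)
      rw [mul_add] at this
      omega

/-- Every state is always entered from the same side, so its position at the edge of a code word is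
determined; this makes one local check per state and symbol sufficient. -/
theorem simulate_step {M : Mach Q S} {M' : TM n m} {code : S → List (Fin m)}
    {enter : Q → Turing.Dir} {σ : Q → Fin n} {f l : ℕ} (hcode : ∀ e, (code e).length = l)
    {q : Q} {h o : ℤ} {tape : ℤ → S} {tape' : ℤ → Fin m}
    (hloc : M.LocalStep M' code enter σ f q (tape h))
    (hc : Codes l code o tape tape') {c : Cfg Q S} (hstep : M.step ⟨some q, h, tape⟩ = c) :
    ∃ t, ∃ c' : TM.Config n m,
      M'.step^[t] ⟨some (σ q), o + l * h + offset l (enter q), tape'⟩ = c' ∧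
      c'.state = c.state.map σ ∧ Codes l code o c.tape c'.tape ∧
      ∀ p, c.state = some p → c'.head = o + l * c.head + offset l (enter p) := by
  -- Both sides of entry in a common form: `ls` is empty for an entry from the left, `rs` for an
  -- entry from the right.
  obtain ⟨ls, a, rs, hrun, hw, hls⟩ : ∃ ls a rs, (match M'.localRun f (σ q) ls a rs,
      M.trans q (tape h) with
      | some (none, _, w), (none, e', _) => w == code e'
      | some (some p, d, w), (some q', e', d') =>
        p == σ q' && d == d' && enter q' == d' && w == code e'
      | _, _ => false) = true ∧ code (tape h) = ls.reverse ++ a :: rs ∧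
      offset l (enter q) = ls.length := by
    unfold LocalStep at hloc
    cases he : enter q with
    | right =>
      cases hw : code (tape h) with
      | nil => simp [he, hw] at hloc
      | cons a rs => exact ⟨[], a, rs, by simpa only [he, hw] using hloc, by simp, by simp [offset]⟩
    | left =>
      cases hw : (code (tape h)).reverse with
      | nil => simp [he, hw] at hloc
      | cons a ls =>
        refine ⟨ls, a, [], by simpa only [he, hw] using hloc, ?_, ?_⟩
        · rw [← List.reverse_reverse (code (tape h)), hw]; simp
        · have := congrArg List.length hw
          rw [List.length_reverse, hcode] at this
          simp [offset, this]
  have hl : ls.length + rs.length + 1 = l := by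
    rw [← hcode (tape h), hw]; simp; omega
  have hH : TM.Holds tape' (o + l * h) (ls.reverse ++ a :: rs) := hw ▸ hc h
  have hc' : c = ⟨(M.trans q (tape h)).1, h + TM.shift (M.trans q (tape h)).2.2,
      Function.update tape h (M.trans q (tape h)).2.1⟩ := hstep.symm
  rw [hls]
  split at hrun
  · rename_i w e' d' hr ht
    obtain ⟨t, c₁, h0, h1, h2, h3, h4, h5⟩ := TM.localRun_spec M' hr rfl hH
    rw [beq_iff_eq] at hrun
    subst hrun
    rw [hl] at h5
    refine ⟨t, c₁, h0, ?_, ?_, ?_⟩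
    · simp [h1, hc', ht]
    · rw [hc', ht]
      exact hc.update hcode h4 h5
    · simp [hc', ht]
  · rename_i p d w q' e' d' hr ht
    obtain ⟨t, c₁, h0, h1, h2, h3, h4, h5⟩ := TM.localRun_spec M' hr rfl hH
    simp only [Bool.and_eq_true, beq_iff_eq] at hrun
    obtain ⟨⟨⟨rfl, rfl⟩, hd⟩, rfl⟩ := hrun
    have h2 := h2 (by simp)
    rw [hl] at h5 h2
    refine ⟨t, c₁, h0, ?_, ?_, ?_⟩
    · simp [h1, hc', ht]
    · rw [hc', ht]
      exact hc.update hcode h4 h5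
    · simp only [hc', ht, Option.some.injEq, forall_eq']
      rw [h2, hd]
      cases d <;> simp [offset, TM.shift] <;> ring
  · simp at hrun

/-- If `M` outputs `v`, then so does a machine that simulates it step by step, each symbol being
coded by a word. -/
theorem Outputs.computes_of_localStep {M : Mach Q S} {v : ℕ} (hM : M.Outputs v) {M' : TM n m}
    {code : S → List (Fin m)} {enter : Q → Turing.Dir} {σ : Q → Fin n} {f l : ℕ}
    (hcode : ∀ e, (code e).length = l) (hinj : Function.Injective code)
    (hblank : code M.blank = List.replicate l M'.blank) (hstart : M'.start = σ M.start)
    (hloc : ∀ q e, M.LocalStep M' code enter σ f q e) : M'.Computes v := by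
  obtain ⟨e, h, p, tape, he, ⟨t, ht⟩, hv, hl, hr⟩ := hM
  -- This origin puts the initial head position `0` at the edge of the code word of cell `0` where
  -- the start state enters.
  set o : ℤ := - offset l (enter M.start) with ho
  have key : ∀ t, ∃ t', (M'.run t').state = (M.step^[t] M.init).state.map σ ∧
      Codes l code o (M.step^[t] M.init).tape (M'.run t').tape ∧
      ∀ p, (M.step^[t] M.init).state = some p →
        (M'.run t').head = o + l * (M.step^[t] M.init).head + offset l (enter p) := by
    intro t
    induction t with
    | zero =>
      refine ⟨0, by simp [TM.run, TM.init, init, hstart], ?_, ?_⟩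
      · intro z i hi
        simp [TM.run, TM.init, init, hblank]
      · simp [init, TM.run, TM.init, ho]
    | succ t ih =>
      obtain ⟨t', h1, h2, h3⟩ := ih
      rw [Function.iterate_succ_apply']
      generalize hc : M.step^[t] M.init = c at h1 h2 h3
      obtain ⟨s, x, tp⟩ := c
      cases s with
      | none => exact ⟨t', h1, h2, by simp [step]⟩
      | some q =>
        obtain ⟨t'', c', h4, h5, h6, h7⟩ := simulate_step hcode (hloc q (tp x)) h2 rfl
        have e1 : M'.run t' = ⟨some (σ q), o + l * x + offset l (enter q), (M'.run t').tape⟩ := by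
          have := h3 q rfl
          rw [← this, ← show (M'.run t').state = some (σ q) from h1]
        rw [← e1, TM.run, ← Function.iterate_add_apply] at h4
        exact ⟨t'' + t', by rw [TM.run, h4]; exact h5, by rw [TM.run, h4]; exact h6,
          by rw [TM.run, h4]; exact h7⟩
  obtain ⟨t', h1, h2, -⟩ := key t
  rw [ht] at h1 h2
  refine M'.computes_of_showsUnary h1 ?_
  -- Injectivity of the code is what keeps the block maximal: an aligned copy of the stroke occurs
  -- only where the simulated tape has `e`.
  have hreads : ∀ z, TM.Reads (M'.run t').tape (o + l * z)
      (fun i : Fin l => (code e)[i]'(by simp [hcode])) ↔ tape z = e := by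
    intro z
    constructor
    · intro hz
      apply hinj
      refine List.ext_getElem (by simp [hcode]) ?_
      intro i hi hi'
      rw [← h2 z i hi]
      exact hz ⟨i, by simpa [hcode] using hi⟩
    · rintro rfl i
      exact h2 z i _
  refine ⟨l, fun i => (code e)[i]'(by simp [hcode]), o + l * p, ?_, fun j hj => ?_, ?_, ?_⟩
  · by_contra hne
    push Not at hne
    refine he (hinj ?_)
    rw [hblank]
    refine List.ext_getElem (by simp [hcode]) ?_
    intro i hi hi'
    rw [List.getElem_replicate]
    exact hne ⟨i, by simpa [hcode] using hi⟩
  · rw [add_assoc, ← mul_add, hreads]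
    exact hv j hj
  · rw [show o + l * p - l = o + l * (p - 1) by ring, hreads]
    exact hl
  · rw [show o + l * p + l * (v + 1) = o + l * (p + (v + 1)) by ring, hreads]
    exact hr

end Mach

/-! ### The search machine -/

namespace Searcher

/-- The marks on the letters of the pattern, and on those of the text. -/
inductive Mark
  | out
  | fresh
  | used
  deriving DecidableEq

instance : Fintype Mark := ⟨{.out, .fresh, .used}, by rintro (_ | _ | _) <;> simp⟩

/-- A tape symbol: the blank, or a letter with its marks in the pattern and in the text. -/
abbrev Sym (K : ℕ) := Option (Fin (K + 1) × Mark × Mark)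

/-- The states of the search machine. -/
inductive St (K : ℕ)
  | seek
  | carry (c : Fin (K + 1))
  | back
  | reset
  | moveText
  | growText
  | growText'
  | dropText
  | movePat
  | growPat
  | growPat'
  | clear
  | incr
  deriving DecidableEq, Fintype

/-- A member of a block becomes available for matching. -/
def Mark.refresh : Mark → Mark
  | .out => .out
  | _ => .fresh

open Turing.Dir in
/-- The transitions of the search machine. -/
def trans {K : ℕ} : St K → Sym K → Option (St K) × Sym K × Turing.Dir
  | .seek, none => (some .incr, none, left)
  | .seek, some (l, .fresh, b) => (some (.carry l), some (l, .used, b), right)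
  | .seek, e => (some .seek, e, right)
  | .carry _, none => (some .reset, none, left)
  | .carry c, some (l, a, .fresh) =>
    if l = c then (some .back, some (l, a, .used), left)
    else (some (.carry c), some (l, a, .used), right)
  | .carry c, e => (some (.carry c), e, right)
  | .back, none => (some .seek, none, right)
  | .back, e => (some .back, e, left)
  | .reset, none => (some .moveText, none, right)
  | .reset, some (l, a, b) => (some .reset, some (l, a.refresh, b.refresh), left)
  | .moveText, none => (some .moveText, none, right)
  | .moveText, some (l, a, .out) => (some .moveText, some (l, a, .out), right)
  | .moveText, some (l, a, _) => (some .growText, some (l, a, .out), right)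
  | .growText, none => (some .dropText, none, left)
  | .growText, some (l, a, .out) => (some .growText', some (l, a, .fresh), right)
  | .growText, some (l, a, _) => (some .growText, some (l, a, .fresh), right)
  | .growText', none => (some .dropText, none, left)
  | .growText', some (l, a, _) => (some .back, some (l, a, .fresh), left)
  | .dropText, none => (some .movePat, none, right)
  | .dropText, some (l, a, _) => (some .dropText, some (l, a, .out), left)
  | .movePat, none => (some .movePat, none, right)
  | .movePat, some (l, .out, b) => (some .movePat, some (l, .out, b), right)
  | .movePat, some (l, _, b) => (some .growPat, some (l, .out, b), right)
  | .growPat, none => (some .clear, some (0, .out, .out), left)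
  | .growPat, some (l, .out, _) => (some .growPat', some (l, .fresh, .fresh), right)
  | .growPat, some (l, _, _) => (some .growPat, some (l, .fresh, .fresh), right)
  | .growPat', none => (some .clear, some (0, .out, .out), left)
  | .growPat', some (l, _, _) => (some .reset, some (l, .fresh, .fresh), left)
  | .clear, none => (some .growPat, none, right)
  | .clear, some (l, _, _) => (some .clear, some (l, .out, .out), left)
  | .incr, none => (none, none, left)
  | .incr, some (l, _, _) =>
    if l = Fin.last K then (some .incr, some (0, .out, .out), left)
    else (some .clear, some (l + 1, .out, .out), left)

/-- The search machine: it runs through the words over `K + 1` letters in lexicographic order,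
keeping the length; when a word has property `(*)`, it appends a letter. -/
def machine (K : ℕ) : Mach (St K) (Sym K) where
  start := .clear
  blank := none
  trans := trans

/-! ### Marked tapes and the comparison of two blocks -/

variable {K : ℕ}

/-- The tape with the word `w` on the cells `1, …, N`, with the marks `a` and `b`. -/
def tp (N : ℤ) (w : ℤ → Fin (K + 1)) (a b : ℤ → Mark) : ℤ → Sym K := fun z =>
  if 1 ≤ z ∧ z ≤ N then some (w z, a z, b z) else none

/-- The marks of a block that ends at `hi`, of which the letters from `lo` up to `mid - 1` have been
used. -/
def run (lo mid hi : ℤ) : ℤ → Mark := fun z =>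
  if lo ≤ z ∧ z < mid then .used else if mid ≤ z ∧ z ≤ hi then .fresh else .out

theorem tp_of_mem {N : ℤ} {w : ℤ → Fin (K + 1)} {a b : ℤ → Mark} {z : ℤ} (h₁ : 1 ≤ z)
    (h₂ : z ≤ N) : tp N w a b z = some (w z, a z, b z) := if_pos ⟨h₁, h₂⟩

theorem tp_of_notMem {N : ℤ} {w : ℤ → Fin (K + 1)} {a b : ℤ → Mark} {z : ℤ}
    (h : z < 1 ∨ N < z) : tp N w a b z = none := if_neg (by omega)

theorem tp_congr {N : ℤ} {w w' : ℤ → Fin (K + 1)} {a b a' b' : ℤ → Mark} {z : ℤ}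
    (hw : w z = w' z) (ha : a z = a' z) (hb : b z = b' z) : tp N w a b z = tp N w' a' b' z := by
  unfold tp
  rw [hw, ha, hb]

theorem tp_eq_update {N : ℤ} {w w' : ℤ → Fin (K + 1)} {a b a' b' : ℤ → Mark} {x : ℤ}
    {e : Sym K} (hx : tp N w' a' b' x = e)
    (h : ∀ z, z ≠ x → 1 ≤ z → z ≤ N → w z = w' z ∧ a z = a' z ∧ b z = b' z) :
    tp N w' a' b' = Function.update (tp N w a b) x e := by
  funext z
  rcases eq_or_ne z x with rfl | hne
  · simpa
  · rw [Function.update_of_ne hne]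
    unfold tp
    split_ifs with hz
    · obtain ⟨h1, h2, h3⟩ := h z hne hz.1 hz.2
      rw [h1, h2, h3]
    · rfl

theorem run_lt {lo mid hi z : ℤ} (h : z < lo) (h' : lo ≤ mid) : run lo mid hi z = .out := by
  unfold run; split_ifs <;> first | rfl | omega

theorem run_gt {lo mid hi z : ℤ} (h : hi < z) (h' : mid ≤ hi + 1) : run lo mid hi z = .out := by
  unfold run; split_ifs <;> first | rfl | omega

theorem run_used {lo mid hi z : ℤ} (h : lo ≤ z) (h' : z < mid) : run lo mid hi z = .used := by
  unfold run; split_ifs <;> first | rfl | omega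

theorem run_fresh {lo mid hi z : ℤ} (h : mid ≤ z) (h' : z ≤ hi) : run lo mid hi z = .fresh := by
  unfold run; split_ifs <;> first | rfl | omega

theorem run_lt_mid {lo mid hi z : ℤ} (h : z < mid) : run lo mid hi z ≠ .fresh := by
  unfold run; split_ifs <;> first | omega | simp

/-- The word `w p, w (p + 1), …` of length `n`. -/
def seg (w : ℤ → Fin (K + 1)) : ℤ → ℕ → List (Fin (K + 1))
  | _, 0 => []
  | p, n + 1 => w p :: seg w (p + 1) n

theorem trans_seek_pass {l : Fin (K + 1)} {a b : Mark} (h : a ≠ .fresh) :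
    trans .seek (some (l, a, b)) = (some .seek, some (l, a, b), .right) := by
  cases a <;> simp_all [trans]

theorem trans_carry_pass {c l : Fin (K + 1)} {a b : Mark} (h : b ≠ .fresh) :
    trans (.carry c) (some (l, a, b)) = (some (.carry c), some (l, a, b), .right) := by
  cases b <;> simp_all [trans]

variable {N : ℤ} {w : ℤ → Fin (K + 1)}

theorem reaches_back {a b : ℤ → Mark} {x : ℤ} (h0 : 0 ≤ x) (hx : x ≤ N) :
    (machine K).Reaches ⟨some .back, x, tp N w a b⟩ ⟨some .seek, 1, tp N w a b⟩ := by
  refine ((machine K).reaches_sweep_left h0 (tape' := tp N w a b) ?_ fun _ _ => rfl).trans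
    ((machine K).reaches_step (e := none) (d := .right) ?_ ?_)
  · intro z h1 h2
    rw [tp_of_mem (by omega) (by omega)]
    rfl
  · rw [tp_of_notMem (by omega)]
    rfl
  · rw [Function.update_eq_self_iff.2 (tp_of_notMem (by omega)).symm]

/-- The letter `c` is matched greedily: if it occurs among the fresh letters of the text, its first
occurrence may be taken without losing a match for the remaining pattern. Letters passed over become
used, so the used part stays an initial piece of the block. -/
theorem reaches_carry {a : ℤ → Mark} {c : Fin (K + 1)} {j f : ℤ} (hf : f ≤ N) (n : ℕ) {x q : ℤ}
    (hx : 1 ≤ x) (hxq : x ≤ q) (hj : j ≤ q) (hn : q + n = f + 1) :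
    (∃ q' n', q < q' ∧ q' + (n' : ℕ) = f + 1 ∧
      (machine K).Reaches ⟨some (.carry c), x, tp N w a (run j q f)⟩
        ⟨some .seek, 1, tp N w a (run j q' f)⟩ ∧
      ∀ l, (c :: l).Sublist (seg w q n) ↔ l.Sublist (seg w q' n')) ∨
    ((machine K).Reaches ⟨some (.carry c), x, tp N w a (run j q f)⟩
        ⟨some .reset, N, tp N w a (run j (f + 1) f)⟩ ∧
      ∀ l, ¬ (c :: l).Sublist (seg w q n)) := by
  induction n generalizing x q with
  | zero =>
    right
    obtain rfl : q = f + 1 := by simpa using hn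
    refine ⟨?_, by simp [seg]⟩
    refine ((machine K).reaches_sweep_right (y := N + 1) (by omega)
      (tape' := tp N w a (run j (f + 1) f)) ?_ fun _ _ => rfl).trans ?_
    · intro z h1 h2
      rw [tp_of_mem (by omega) (by omega)]
      refine trans_carry_pass ?_
      rcases lt_or_ge z (f + 1) with h | h
      · exact run_lt_mid h
      · rw [run_gt (by omega) (by omega)]; simp
    · have := (machine K).reaches_step (q := .carry c) (h := N + 1)
        (tape := tp N w a (run j (f + 1) f)) (tape' := tp N w a (run j (f + 1) f))
        (q' := some .reset) (e := none) (d := .left)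
        (by rw [tp_of_notMem (by omega)]; rfl)
        (by rw [Function.update_eq_self_iff.2 (tp_of_notMem (by omega)).symm])
      simpa [TM.shift] using this
  | succ n ih =>
    push_cast at hn
    have h1 : (machine K).Reaches ⟨some (.carry c), x, tp N w a (run j q f)⟩
        ⟨some (.carry c), q, tp N w a (run j q f)⟩ := by
      refine (machine K).reaches_sweep_right hxq ?_ fun _ _ => rfl
      intro z h1 h2
      rw [tp_of_mem (by omega) (by omega)]
      exact trans_carry_pass (run_lt_mid h2)
    have h2 : tp N w a (run j q f) q = some (w q, a q, .fresh) := by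
      rw [tp_of_mem (by omega) (by omega), run_fresh le_rfl (by omega)]
    have h3 : tp N w a (run j (q + 1) f) =
        Function.update (tp N w a (run j q f)) q (some (w q, a q, .used)) := by
      refine tp_eq_update ?_ ?_
      · rw [tp_of_mem (by omega) (by omega), run_used hj (by omega)]
      · intro z hz _ _
        refine ⟨rfl, rfl, ?_⟩
        unfold run
        split_ifs <;> first | rfl | omega
    by_cases hc : w q = c
    · left
      refine ⟨q + 1, n, by omega, by omega, ?_, ?_⟩
      · refine (h1.trans ((machine K).reaches_step (q' := some .back) (d := .left) ?_ h3)).trans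
          (reaches_back ?_ ?_)
        · rw [h2]
          simp [machine, trans, hc]
        · simp only [TM.shift]; omega
        · simp only [TM.shift]; omega
      · intro l
        rw [seg, hc, List.cons_sublist_cons]
    · have h4 := h1.trans ((machine K).reaches_step (q' := some (.carry c)) (d := .right)
        (by rw [h2]; simp [machine, trans, hc]) h3)
      have h5 : ∀ l, (c :: l).Sublist (seg w q (n + 1)) ↔ (c :: l).Sublist (seg w (q + 1) n) := by
        intro l
        rw [seg, List.cons_sublist_cons']
        simp [Ne.symm hc]
      rcases ih (x := q + 1) (q := q + 1) (by omega) le_rfl (by omega) (by omega) with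
        ⟨q', n', i1, i2, i3, i4⟩ | ⟨i1, i2⟩
      · exact Or.inl ⟨q', n', by omega, i2, h4.trans i3, fun l => (h5 l).trans (i4 l)⟩
      · exact Or.inr ⟨h4.trans i1, fun l => (h5 l).not.2 (i2 l)⟩

/-- Greedy matching decides the subword relation. The invariant `p < q` keeps the next pattern
letter to the left of the next text letter, so a head that goes right from the first always meets
the second, even when the blocks overlap. -/
theorem reaches_match {i e j f : ℤ} (hi : 1 ≤ i) (he : e ≤ N) (hf : f ≤ N) (n n' : ℕ) {p q : ℤ}
    (hip : i ≤ p) (hpq : p < q) (hj : j ≤ q) (hn : p + n = e + 1) (hn' : q + n' = f + 1) :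
    ((seg w p n).Sublist (seg w q n') ∧ ∃ a b,
      (machine K).Reaches ⟨some .seek, 1, tp N w (run i p e) (run j q f)⟩
        ⟨some .incr, N, tp N w a b⟩) ∨
    (¬ (seg w p n).Sublist (seg w q n') ∧ ∃ p', i ≤ p' ∧ p' ≤ e + 1 ∧
      (machine K).Reaches ⟨some .seek, 1, tp N w (run i p e) (run j q f)⟩
        ⟨some .reset, N, tp N w (run i p' e) (run j (f + 1) f)⟩) := by
  induction n generalizing p q n' with
  | zero =>
    left
    obtain rfl : p = e + 1 := by simpa using hn
    refine ⟨by simp [seg], run i (e + 1) e, run j q f, ?_⟩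
    refine ((machine K).reaches_sweep_right (y := N + 1) (by omega)
      (tape' := tp N w (run i (e + 1) e) (run j q f)) ?_ fun _ _ => rfl).trans ?_
    · intro z h1 h2
      rw [tp_of_mem (by omega) (by omega)]
      refine trans_seek_pass ?_
      rcases lt_or_ge z (e + 1) with h | h
      · exact run_lt_mid h
      · rw [run_gt (by omega) (by omega)]; simp
    · have := (machine K).reaches_step (q := .seek) (h := N + 1)
        (tape := tp N w (run i (e + 1) e) (run j q f))
        (tape' := tp N w (run i (e + 1) e) (run j q f))
        (q' := some .incr) (e := none) (d := .left)
        (by rw [tp_of_notMem (by omega)]; rfl)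
        (by rw [Function.update_eq_self_iff.2 (tp_of_notMem (by omega)).symm])
      simpa [TM.shift] using this
  | succ n ih =>
    push_cast at hn
    have h1 : (machine K).Reaches ⟨some .seek, 1, tp N w (run i p e) (run j q f)⟩
        ⟨some .seek, p, tp N w (run i p e) (run j q f)⟩ := by
      refine (machine K).reaches_sweep_right (by omega) ?_ fun _ _ => rfl
      intro z h1 h2
      rw [tp_of_mem (by omega) (by omega)]
      exact trans_seek_pass (run_lt_mid h2)
    have h2 : tp N w (run i p e) (run j q f) p = some (w p, .fresh, run j q f p) := by
      rw [tp_of_mem (by omega) (by omega), run_fresh le_rfl (by omega)]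
    have h3 : tp N w (run i (p + 1) e) (run j q f) =
        Function.update (tp N w (run i p e) (run j q f)) p (some (w p, .used, run j q f p)) := by
      refine tp_eq_update ?_ ?_
      · rw [tp_of_mem (by omega) (by omega), run_used hip (by omega)]
      · intro z hz _ _
        refine ⟨rfl, ?_, rfl⟩
        unfold run
        split_ifs <;> first | rfl | omega
    have h4 := h1.trans ((machine K).reaches_step (q' := some (.carry (w p))) (d := .right)
        (by rw [h2]; rfl) h3)
    rcases reaches_carry (w := w) (a := run i (p + 1) e) (c := w p) hf n' (x := p + 1)
      (by omega) (by omega) hj hn' with ⟨q', n'', i1, i2, i3, i4⟩ | ⟨i1, i2⟩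
    · rcases ih n'' (p := p + 1) (q := q') (by omega) (by omega) (by omega) (by omega) i2 with
        ⟨k1, a, b, k2⟩ | ⟨k1, p', k2, k3, k4⟩
      · exact Or.inl ⟨(i4 _).2 k1, a, b, (h4.trans i3).trans k2⟩
      · exact Or.inr ⟨(i4 _).not.2 k1, p', k2, k3, (h4.trans i3).trans k4⟩
    · exact Or.inr ⟨i2 _, p + 1, by omega, by omega, h4.trans i1⟩

theorem refresh_run {lo mid hi z : ℤ} (h : lo ≤ mid) (h' : mid ≤ hi + 1) :
    (run lo mid hi z).refresh = run lo lo hi z := by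
  unfold run
  split_ifs <;> first | rfl | omega

/-- The sweep only reaches cells up to `x`, so used letters must lie there. The alternatives `p = i`
and `q = j` cover blocks without used letters, which may extend beyond `x`. -/
theorem reaches_reset {i p e j q f x : ℤ} (hx : x ≤ N) (h0 : 0 ≤ x) (hp : i ≤ p) (hpe : p ≤ e + 1)
    (hpx : p ≤ x + 1 ∨ p = i) (hq : j ≤ q) (hqf : q ≤ f + 1) (hqx : q ≤ x + 1 ∨ q = j) :
    (machine K).Reaches ⟨some .reset, x, tp N w (run i p e) (run j q f)⟩
      ⟨some .moveText, 1, tp N w (run i i e) (run j j f)⟩ := by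
  refine ((machine K).reaches_sweep_left h0 (tape' := tp N w (run i i e) (run j j f)) ?_ ?_).trans
    ((machine K).reaches_step (e := none) (d := .right) ?_ ?_)
  · intro z h1 h2
    rw [tp_of_mem (by omega) (by omega), tp_of_mem (by omega) (by omega),
      ← refresh_run hp hpe, ← refresh_run hq hqf]
    rfl
  · intro z hz
    rcases hz with hz | hz
    · rw [tp_of_notMem (by omega), tp_of_notMem (by omega)]
    · refine tp_congr rfl ?_ ?_ <;> unfold run <;> split_ifs <;> first | rfl | omega
  · rw [tp_of_notMem (by omega)]
    rfl
  · rw [Function.update_eq_self_iff.2 (tp_of_notMem (by omega)).symm]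

end Searcher

/-! ### Moving the blocks, testing a word, and passing to the next word -/

namespace Searcher

variable {K : ℕ} {N : ℤ} {w : ℤ → Fin (K + 1)}

theorem reaches_turn {q q' : St K} {a b : ℤ → Mark}
    (h : trans q none = (some q', none, .left)) :
    (machine K).Reaches ⟨some q, N + 1, tp N w a b⟩ ⟨some q', N, tp N w a b⟩ := by
  have := (machine K).reaches_step (q := q) (h := N + 1)
    (tape := tp N w a b) (tape' := tp N w a b) (q' := some q') (e := none) (d := .left)
    (by rw [tp_of_notMem (by omega)]; exact h)
    (by rw [Function.update_eq_self_iff.2 (tp_of_notMem (by omega)).symm])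
  simpa [TM.shift] using this

/-- Passing from `j` to `j + 1` removes one letter at the front of the text block and adds two at
its end. If these do not fit, the text marks are left arbitrary, since `dropText` erases them. -/
theorem reaches_moveText {a : ℤ → Mark} {j f : ℤ} (hj : 1 ≤ j) (hjf : j ≤ f) (hf : f ≤ N) :
    (f + 2 ≤ N ∧ (machine K).Reaches ⟨some .moveText, 1, tp N w a (run j j f)⟩
      ⟨some .seek, 1, tp N w a (run (j + 1) (j + 1) (f + 2))⟩) ∨
    (N < f + 2 ∧ ∃ b, (machine K).Reaches ⟨some .moveText, 1, tp N w a (run j j f)⟩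
      ⟨some .dropText, N, tp N w a b⟩) := by
  have h1 : (machine K).Reaches ⟨some .moveText, 1, tp N w a (run j j f)⟩
      ⟨some .moveText, j, tp N w a (run j j f)⟩ := by
    refine (machine K).reaches_sweep_right hj ?_ fun _ _ => rfl
    intro z h1 h2
    rw [tp_of_mem (by omega) (by omega), run_lt h2 le_rfl]
    rfl
  have h2 := h1.trans ((machine K).reaches_step (q' := some .growText) (d := .right)
    (e := some (w j, a j, .out)) (tape' := tp N w a (run (j + 1) (j + 1) f))
    (by rw [tp_of_mem (by omega) (by omega), run_fresh le_rfl (by omega)]; rfl)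
    (tp_eq_update (by rw [tp_of_mem (by omega) (by omega), run_lt (by omega) (by omega)]) (by
      intro z hz _ _
      refine ⟨rfl, rfl, ?_⟩
      unfold run
      split_ifs <;> first | rfl | omega)))
  have h3 : (machine K).Reaches ⟨some .moveText, 1, tp N w a (run j j f)⟩
      ⟨some .growText, f + 1, tp N w a (run (j + 1) (j + 1) f)⟩ := by
    refine h2.trans ((machine K).reaches_sweep_right (by simp only [TM.shift]; omega) ?_
      fun _ _ => rfl)
    intro z h1 h2
    simp only [TM.shift] at h1
    rw [tp_of_mem (by omega) (by omega), run_fresh (by omega) (by omega)]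
    rfl
  rcases eq_or_lt_of_le hf with rfl | hf
  · exact Or.inr ⟨by omega, _, h3.trans (reaches_turn rfl)⟩
  have h4 := h3.trans ((machine K).reaches_step (q' := some .growText') (d := .right)
    (e := some (w (f + 1), a (f + 1), .fresh)) (tape' := tp N w a (run (j + 1) (j + 1) (f + 1)))
    (by rw [tp_of_mem (by omega) (by omega), run_gt (by omega) (by omega)]; rfl)
    (tp_eq_update (by rw [tp_of_mem (by omega) (by omega), run_fresh (by omega) (by omega)]) (by
      intro z hz _ _
      refine ⟨rfl, rfl, ?_⟩
      unfold run
      split_ifs <;> first | rfl | omega)))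
  rcases eq_or_lt_of_le (show f + 1 ≤ N by omega) with rfl | hf
  · exact Or.inr ⟨by omega, _, h4.trans (reaches_turn rfl)⟩
  left
  refine ⟨by omega, ?_⟩
  have h5 := h4.trans ((machine K).reaches_step (q' := some .back) (d := .left)
    (e := some (w (f + 2), a (f + 2), .fresh)) (tape' := tp N w a (run (j + 1) (j + 1) (f + 2)))
    (by rw [tp_of_mem (by simp only [TM.shift]; omega) (by simp only [TM.shift]; omega)]
        simp [TM.shift, add_assoc, machine, trans])
    (tp_eq_update (by
        simp only [TM.shift]
        rw [tp_of_mem (by omega) (by omega), run_fresh (by omega) (by omega)]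
        simp [add_assoc]) (by
      intro z hz _ _
      simp only [TM.shift] at hz
      refine ⟨rfl, rfl, ?_⟩
      unfold run
      split_ifs <;> first | rfl | omega)))
  exact h5.trans (reaches_back (by simp only [TM.shift]; omega) (by simp only [TM.shift]; omega))

/-- The block of `i + 1` letters from the `i`-th on. -/
def blk (w : ℤ → Fin (K + 1)) (i : ℕ) : List (Fin (K + 1)) := seg w i (i + 1)

/-- The inner loop, with a fixed pattern block. The number `d` bounds how many text blocks remain.
-/
theorem reaches_pairs {i : ℕ} (hi : 1 ≤ i) (d : ℕ) {j : ℕ} (hij : i < j) (hj : 2 * j ≤ N)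
    (hd : N < 2 * (j + d)) :
    ((∃ j' : ℕ, j ≤ j' ∧ 2 * j' ≤ N ∧ (blk w i).Sublist (blk w j')) ∧ ∃ a b,
      (machine K).Reaches ⟨some .seek, 1, tp N w (run i i (2 * i)) (run j j (2 * j))⟩
        ⟨some .incr, N, tp N w a b⟩) ∨
    ((∀ j' : ℕ, j ≤ j' → 2 * j' ≤ N → ¬ (blk w i).Sublist (blk w j')) ∧ ∃ b,
      (machine K).Reaches ⟨some .seek, 1, tp N w (run i i (2 * i)) (run j j (2 * j))⟩
        ⟨some .dropText, N, tp N w (run i i (2 * i)) b⟩) := by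
  induction d generalizing j with
  | zero => push_cast at hd; omega
  | succ d ih =>
    rcases reaches_match (w := w) (N := N) (i := i) (e := 2 * i) (j := j) (f := 2 * j) (by omega)
      (by omega) hj (i + 1) (j + 1) (p := i) (q := j) le_rfl (by omega) le_rfl (by push_cast; ring)
      (by push_cast; ring) with ⟨h1, a, b, h2⟩ | ⟨h1, p', h2, h3, h4⟩
    · exact Or.inl ⟨⟨j, le_rfl, hj, h1⟩, a, b, h2⟩
    have h5 := h4.trans (reaches_reset le_rfl (by omega) h2 h3 (by omega) (by omega) le_rfl
      (by omega))
    rcases reaches_moveText (w := w) (N := N) (a := run i i (2 * i)) (j := j) (f := 2 * j)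
      (by omega) (by omega) hj with ⟨h6, h7⟩ | ⟨h6, b, h7⟩
    · have h8 := h5.trans h7
      have e1 : 2 * (j : ℤ) + 2 = 2 * ((j + 1 : ℕ) : ℤ) := by push_cast; ring
      have e2 : (j : ℤ) + 1 = ((j + 1 : ℕ) : ℤ) := by push_cast; ring
      rw [e1, e2] at h8
      rcases ih (j := j + 1) (by omega) (by omega) (by push_cast at hd ⊢; omega) with
        ⟨⟨j', k1, k2, k3⟩, a, b, k4⟩ | ⟨k1, b, k2⟩
      · exact Or.inl ⟨⟨j', by omega, k2, k3⟩, a, b, h8.trans k4⟩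
      · refine Or.inr ⟨fun j' hj' hN => ?_, b, h8.trans k2⟩
        rcases eq_or_lt_of_le hj' with rfl | hlt
        · exact h1
        · exact k1 j' (by omega) hN
    · refine Or.inr ⟨fun j' hj' hN => ?_, b, h5.trans h7⟩
      obtain rfl : j = j' := by omega
      exact h1

theorem reaches_dropText {i e : ℤ} {b : ℤ → Mark} (hi : 1 ≤ i) (hie : i ≤ e) (he : e ≤ N) :
    (machine K).Reaches ⟨some .dropText, N, tp N w (run i i e) b⟩
      ⟨some .growPat, i + 1, tp N w (run (i + 1) (i + 1) e) (fun _ => .out)⟩ := by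
  have h1 : (machine K).Reaches ⟨some .dropText, N, tp N w (run i i e) b⟩
      ⟨some .movePat, 1, tp N w (run i i e) (fun _ => .out)⟩ := by
    refine ((machine K).reaches_sweep_left (y := 0) (by omega)
      (tape' := tp N w (run i i e) (fun _ => .out)) ?_ ?_).trans
      ((machine K).reaches_step (e := none) (d := .right) ?_ ?_)
    · intro z h1 h2
      rw [tp_of_mem (by omega) (by omega), tp_of_mem (by omega) (by omega)]
      rfl
    · intro z hz
      rw [tp_of_notMem (by omega), tp_of_notMem (by omega)]
    · rw [tp_of_notMem (by omega)]
      rfl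
    · rw [Function.update_eq_self_iff.2 (tp_of_notMem (by omega)).symm]
  have h2 : (machine K).Reaches ⟨some .movePat, 1, tp N w (run i i e) (fun _ => .out)⟩
      ⟨some .movePat, i, tp N w (run i i e) (fun _ => .out)⟩ := by
    refine (machine K).reaches_sweep_right hi ?_ fun _ _ => rfl
    intro z h1 h2
    rw [tp_of_mem (by omega) (by omega), run_lt h2 le_rfl]
    rfl
  refine (h1.trans h2).trans ((machine K).reaches_step (q' := some .growPat) (d := .right)
    (e := some (w i, .out, .out))
    (by rw [tp_of_mem (by omega) (by omega), run_fresh le_rfl (by omega)]; rfl)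
    (tp_eq_update (by rw [tp_of_mem (by omega) (by omega), run_lt (by omega) (by omega)]) (by
      intro z hz _ _
      refine ⟨rfl, ?_, rfl⟩
      unfold run
      split_ifs <;> first | rfl | omega)))

/-- The marks beyond `N` were invisible on the shorter tape; they are replaced by `.out` so that
they describe the new cell correctly. -/
theorem reaches_append {q : St K} {a b : ℤ → Mark} (hN : 0 ≤ N)
    (h : trans q none = (some .clear, some ((0 : Fin (K + 1)), .out, .out), .left)) :
    ∃ a' b', (machine K).Reaches ⟨some q, N + 1, tp N w a b⟩
      ⟨some .clear, N, tp (N + 1) (Function.update w (N + 1) 0) a' b'⟩ ∧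
      ∀ z, N < z → a' z = .out ∧ b' z = .out := by
  refine ⟨fun z => if z ≤ N then a z else .out, fun z => if z ≤ N then b z else .out, ?_, ?_⟩
  · have := (machine K).reaches_step (q := q) (h := N + 1) (tape := tp N w a b)
      (tape' := tp (N + 1) (Function.update w (N + 1) 0) (fun z => if z ≤ N then a z else .out)
        (fun z => if z ≤ N then b z else .out)) (q' := some .clear)
      (e := some (0, .out, .out)) (d := .left)
      (by rw [tp_of_notMem (by omega)]; exact h) ?_
    · simpa [TM.shift] using this
    · funext z
      rcases eq_or_ne z (N + 1) with rfl | hne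
      · rw [tp_of_mem (by omega) le_rfl]
        simp
      · rw [Function.update_of_ne hne]
        simp only [tp, Function.update_of_ne hne]
        split_ifs <;> first | rfl | omega
  · intro z hz
    simp only [if_neg (not_le.2 hz), and_self]

/-- The pattern loses its first letter before this phase, which appends two and copies the block
into the text marks. So the text starts on top of the pattern, and a subsequent `moveText` makes `i
+ 1` the first text tried. The case `x = e + 1` is the empty block before the first pattern. -/
theorem reaches_growPat {x e : ℤ} (hx : 1 ≤ x) (hxe : x ≤ e + 1) (he : e ≤ N) :
    (e + 2 ≤ N ∧
      (machine K).Reaches ⟨some .growPat, x, tp N w (run x x e) (fun _ => .out)⟩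
        ⟨some .moveText, 1, tp N w (run x x (e + 2)) (run x x (e + 2))⟩) ∨
    (N < e + 2 ∧ ∃ a b,
      (machine K).Reaches ⟨some .growPat, x, tp N w (run x x e) (fun _ => .out)⟩
        ⟨some .clear, N, tp (N + 1) (Function.update w (N + 1) 0) a b⟩ ∧
      ∀ z, N < z → a z = .out ∧ b z = .out) := by
  have h1 : (machine K).Reaches ⟨some .growPat, x, tp N w (run x x e) (fun _ => .out)⟩
      ⟨some .growPat, e + 1, tp N w (run x x e) (run x x e)⟩ := by
    refine (machine K).reaches_sweep_right hxe ?_ ?_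
    · intro z h1 h2
      rw [tp_of_mem (by omega) (by omega), tp_of_mem (by omega) (by omega),
        run_fresh (by omega) (by omega)]
      rfl
    · intro z hz
      refine tp_congr rfl rfl ?_
      unfold run
      split_ifs <;> first | rfl | omega
  rcases eq_or_lt_of_le he with rfl | he
  · obtain ⟨a, b, h2, h3⟩ := reaches_append (q := .growPat) (w := w) (N := e) (a := run x x e)
      (b := run x x e) (by omega) rfl
    exact Or.inr ⟨by omega, a, b, h1.trans h2, h3⟩
  have h2 := h1.trans ((machine K).reaches_step (q' := some .growPat') (d := .right)
    (e := some (w (e + 1), .fresh, .fresh))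
    (tape' := tp N w (run x x (e + 1)) (run x x (e + 1)))
    (by rw [tp_of_mem (by omega) (by omega), run_gt (by omega) (by omega)]; rfl)
    (tp_eq_update (by rw [tp_of_mem (by omega) (by omega), run_fresh (by omega) (by omega)]) (by
      intro z hz _ _
      refine ⟨rfl, ?_, ?_⟩ <;>
      · unfold run
        split_ifs <;> first | rfl | omega)))
  rcases eq_or_lt_of_le (show e + 1 ≤ N by omega) with rfl | he
  · obtain ⟨a, b, h3, h4⟩ := reaches_append (q := .growPat') (w := w) (N := e + 1)
      (a := run x x (e + 1)) (b := run x x (e + 1)) (by omega) rfl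
    exact Or.inr ⟨by omega, a, b, h2.trans h3, h4⟩
  left
  refine ⟨by omega, ?_⟩
  have h3 := h2.trans ((machine K).reaches_step (q' := some .reset) (d := .left)
    (e := some (w (e + 2), .fresh, .fresh))
    (tape' := tp N w (run x x (e + 2)) (run x x (e + 2)))
    (by rw [tp_of_mem (by simp only [TM.shift]; omega) (by simp only [TM.shift]; omega)]
        simp [TM.shift, add_assoc, machine, trans])
    (tp_eq_update (by
        simp only [TM.shift]
        rw [tp_of_mem (by omega) (by omega), run_fresh (by omega) (by omega)]
        simp [add_assoc]) (by
      intro z hz _ _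
      simp only [TM.shift] at hz
      refine ⟨rfl, ?_, ?_⟩ <;>
      · unfold run
        split_ifs <;> first | rfl | omega)))
  exact h3.trans (reaches_reset (by simp only [TM.shift]; omega) (by simp only [TM.shift]; omega)
    le_rfl (by omega) (by omega) le_rfl (by omega) (by omega))

/-- The outer loop. Its invariant stands between two patterns: block `i` is finished and has lost
its first letter. When the next pattern does not fit, every pair has been refuted and a letter is
appended. -/
theorem reaches_patterns (d : ℕ) {i : ℕ} (hi : 2 * i ≤ N) (hd : N < 2 * (i + d)) :
    ((∃ i' j : ℕ, i < i' ∧ i' < j ∧ 2 * j ≤ N ∧ (blk w i').Sublist (blk w j)) ∧ ∃ a b,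
      (machine K).Reaches
        ⟨some .growPat, i + 1, tp N w (run (i + 1) (i + 1) (2 * i)) (fun _ => .out)⟩
        ⟨some .incr, N, tp N w a b⟩) ∨
    ((∀ i' j : ℕ, i < i' → i' < j → 2 * j ≤ N → ¬ (blk w i').Sublist (blk w j)) ∧ ∃ a b,
      (machine K).Reaches
        ⟨some .growPat, i + 1, tp N w (run (i + 1) (i + 1) (2 * i)) (fun _ => .out)⟩
        ⟨some .clear, N, tp (N + 1) (Function.update w (N + 1) 0) a b⟩ ∧
        ∀ z, N < z → a z = .out ∧ b z = .out) := by
  induction d generalizing i with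
  | zero => push_cast at hd; omega
  | succ d ih =>
    rcases reaches_growPat (w := w) (N := N) (x := i + 1) (e := 2 * i) (by omega) (by omega) hi with
      ⟨h1, h2⟩ | ⟨h1, a, b, h2, h3⟩
    swap
    · exact Or.inr ⟨fun i' j _ _ _ => by omega, a, b, h2, h3⟩
    have e1 : 2 * (i : ℤ) + 2 = 2 * ((i + 1 : ℕ) : ℤ) := by push_cast; ring
    have e2 : (i : ℤ) + 1 = ((i + 1 : ℕ) : ℤ) := by push_cast; ring
    rw [e1, e2] at h2
    rw [e2]
    -- Common end of two cases, in which all texts for pattern `i + 1` failed or there was none: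
    -- drop the text and apply induction.
    have next : ∀ b, (machine K).Reaches
        ⟨some .growPat, ((i + 1 : ℕ) : ℤ), tp N w (run (i + 1 : ℕ) (i + 1 : ℕ) (2 * i))
          (fun _ => .out)⟩
        ⟨some .dropText, N, tp N w (run (i + 1 : ℕ) (i + 1 : ℕ) (2 * (i + 1 : ℕ))) b⟩ →
        (∀ j : ℕ, i + 1 < j → 2 * j ≤ N → ¬ (blk w (i + 1)).Sublist (blk w j)) →
        ((∃ i' j : ℕ, i < i' ∧ i' < j ∧ 2 * j ≤ N ∧ (blk w i').Sublist (blk w j)) ∧ ∃ a b,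
          (machine K).Reaches
            ⟨some .growPat, ((i + 1 : ℕ) : ℤ), tp N w (run (i + 1 : ℕ) (i + 1 : ℕ) (2 * i))
              (fun _ => .out)⟩
            ⟨some .incr, N, tp N w a b⟩) ∨
        ((∀ i' j : ℕ, i < i' → i' < j → 2 * j ≤ N → ¬ (blk w i').Sublist (blk w j)) ∧ ∃ a b,
          (machine K).Reaches
            ⟨some .growPat, ((i + 1 : ℕ) : ℤ), tp N w (run (i + 1 : ℕ) (i + 1 : ℕ) (2 * i))
              (fun _ => .out)⟩
            ⟨some .clear, N, tp (N + 1) (Function.update w (N + 1) 0) a b⟩ ∧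
            ∀ z, N < z → a z = .out ∧ b z = .out) := by
      intro b hb hno
      have hb := hb.trans (reaches_dropText (by omega) (by omega) (by omega))
      rcases ih (i := i + 1) (by omega) (by push_cast at hd ⊢; omega) with
        ⟨⟨i', j, k1, k2, k3, k4⟩, a, b, k5⟩ | ⟨k1, a, b, k2, k3⟩
      · exact Or.inl ⟨⟨i', j, by omega, k2, k3, k4⟩, a, b, hb.trans k5⟩
      · refine Or.inr ⟨fun i' j hi' hij hj => ?_, a, b, hb.trans k2, k3⟩
        rcases eq_or_lt_of_le (Nat.succ_le_of_lt hi') with rfl | hlt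
        · exact hno j hij hj
        · exact k1 i' j (by omega) hij hj
    rcases reaches_moveText (w := w) (N := N) (a := run (i + 1 : ℕ) (i + 1 : ℕ) (2 * (i + 1 : ℕ)))
      (j := (i + 1 : ℕ)) (f := 2 * (i + 1 : ℕ)) (by omega) (by omega) (by omega) with
      ⟨h6, h7⟩ | ⟨h6, b, h7⟩
    · have h8 := h2.trans h7
      have e1 : 2 * ((i + 1 : ℕ) : ℤ) + 2 = 2 * ((i + 2 : ℕ) : ℤ) := by push_cast; ring
      have e2 : ((i + 1 : ℕ) : ℤ) + 1 = ((i + 2 : ℕ) : ℤ) := by push_cast; ring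
      rw [e1, e2] at h8
      rcases reaches_pairs (w := w) (N := N) (i := i + 1) (by omega) (d + 1) (j := i + 2) (by omega)
        (by omega) (by push_cast at hd ⊢; omega) with ⟨⟨j', k1, k2, k3⟩, a, b, k4⟩ | ⟨k1, b, k2⟩
      · exact Or.inl ⟨⟨i + 1, j', by omega, by omega, k2, k3⟩, a, b, h8.trans k4⟩
      · exact next b (h8.trans k2) fun j hj => k1 j (by omega)
    · exact next b (h2.trans h7) fun j hj hN => by omega

theorem reaches_clear {a b : ℤ → Mark} {x : ℤ} (h0 : 0 ≤ x) (hx : x ≤ N)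
    (hab : ∀ z, x < z → z ≤ N → a z = .out ∧ b z = .out) :
    (machine K).Reaches ⟨some .clear, x, tp N w a b⟩
      ⟨some .growPat, 1, tp N w (fun _ => .out) (fun _ => .out)⟩ := by
  refine ((machine K).reaches_sweep_left h0
    (tape' := tp N w (fun _ => .out) (fun _ => .out)) ?_ ?_).trans
    ((machine K).reaches_step (e := none) (d := .right) ?_ ?_)
  · intro z h1 h2
    rw [tp_of_mem (by omega) (by omega), tp_of_mem (by omega) (by omega)]
    rfl
  · intro z hz
    by_cases h : 1 ≤ z ∧ z ≤ N
    · obtain ⟨h1, h2⟩ := hab z (by omega) h.2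
      exact tp_congr rfl h1.symm h2.symm
    · rw [tp_of_notMem (by omega), tp_of_notMem (by omega)]
  · rw [tp_of_notMem (by omega)]
    rfl
  · rw [Function.update_eq_self_iff.2 (tp_of_notMem (by omega)).symm]

/-- The test of a word. -/
theorem reaches_test (h0 : 0 ≤ N) :
    ((∃ i j : ℕ, 1 ≤ i ∧ i < j ∧ 2 * j ≤ N ∧ (blk w i).Sublist (blk w j)) ∧ ∃ a b,
      (machine K).Reaches ⟨some .growPat, 1, tp N w (fun _ => .out) (fun _ => .out)⟩
        ⟨some .incr, N, tp N w a b⟩) ∨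
    ((∀ i j : ℕ, 1 ≤ i → i < j → 2 * j ≤ N → ¬ (blk w i).Sublist (blk w j)) ∧
      (machine K).Reaches ⟨some .growPat, 1, tp N w (fun _ => .out) (fun _ => .out)⟩
        ⟨some .growPat, 1,
          tp (N + 1) (Function.update w (N + 1) 0) (fun _ => .out) (fun _ => .out)⟩) := by
  -- An unmarked tape is the stage after a fictitious block `0`, which is empty; so the outer loop
  -- starts with `i = 0`.
  have e : (fun _ => .out) = run 1 1 0 := by
    funext z
    unfold run
    split_ifs <;> first | rfl | omega
  have := reaches_patterns (w := w) (N := N) (N.toNat + 1) (i := 0) (by simpa) (by omega)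
  simp only [Nat.cast_zero, mul_zero, zero_add, ← e] at this
  rcases this with h | ⟨h1, a, b, h2, h3⟩
  · exact Or.inl h
  · exact Or.inr ⟨h1, h2.trans (reaches_clear h0 (by omega) fun z h _ => h3 z h)⟩

/-- The passage to the next word. -/
theorem reaches_next (h0 : 0 ≤ N) (a b : ℤ → Mark) :
    ((∀ z, 1 ≤ z → z ≤ N → w z = Fin.last K) ∧
      (machine K).Reaches ⟨some .incr, N, tp N w a b⟩
        ⟨none, -1, tp N (fun _ => 0) (fun _ => .out) (fun _ => .out)⟩) ∨
    ∃ x, 1 ≤ x ∧ x ≤ N ∧ w x ≠ Fin.last K ∧ (∀ z, x < z → z ≤ N → w z = Fin.last K) ∧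
      (machine K).Reaches ⟨some .incr, N, tp N w a b⟩
        ⟨some .growPat, 1, tp N (fun z => if z < x then w z else if z = x then w z + 1 else 0)
          (fun _ => .out) (fun _ => .out)⟩ := by
  have sweep : ∀ x, 0 ≤ x → x ≤ N → (∀ z, x < z → z ≤ N → w z = Fin.last K) →
      (machine K).Reaches ⟨some .incr, N, tp N w a b⟩
        ⟨some .incr, x, tp N (fun z => if z ≤ x then w z else 0)
          (fun z => if z ≤ x then a z else .out) (fun z => if z ≤ x then b z else .out)⟩ := by
    intro x hx hxN hlast
    refine (machine K).reaches_sweep_left hxN ?_ ?_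
    · intro z h1 h2
      rw [tp_of_mem (by omega) (by omega), tp_of_mem (by omega) (by omega), hlast z h1 h2]
      simp [machine, trans, not_le.2 h1]
    · intro z hz
      simp only [tp]
      split_ifs <;> first | rfl | omega
  by_cases hall : ∀ z, 1 ≤ z → z ≤ N → w z = Fin.last K
  · left
    refine ⟨hall, (sweep 0 le_rfl h0 fun z h1 h2 => hall z (by omega) h2).trans ?_⟩
    refine (machine K).reaches_step (q' := none) (e := none) (d := .left) ?_ ?_
    · rw [tp_of_notMem (by omega)]
      rfl
    · rw [Function.update_eq_self_iff.2 (tp_of_notMem (by omega)).symm]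
      funext z
      simp only [tp]
      split_ifs <;> first | rfl | omega
  · right
    push Not at hall
    obtain ⟨z₀, hz1, hz2, hz3⟩ := hall
    obtain ⟨x, ⟨hx1, hx2, hx3⟩, hmax⟩ := Int.exists_greatest_of_bdd
      (P := fun z => 1 ≤ z ∧ z ≤ N ∧ w z ≠ Fin.last K) ⟨N, fun z hz => hz.2.1⟩ ⟨z₀, hz1, hz2, hz3⟩
    have hlast : ∀ z, x < z → z ≤ N → w z = Fin.last K := by
      intro z h1 h2
      by_contra h
      have := hmax z ⟨by omega, h2, h⟩
      omega
    refine ⟨x, hx1, hx2, hx3, hlast, ?_⟩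
    have h1 := (sweep x (by omega) hx2 hlast).trans ((machine K).reaches_step
      (q' := some .clear) (e := some (w x + 1, .out, .out)) (d := .left)
      (tape' := tp N (fun z => if z < x then w z else if z = x then w z + 1 else 0)
        (fun z => if z < x then a z else .out) (fun z => if z < x then b z else .out)) ?_ ?_)
    · exact h1.trans (reaches_clear (by simp only [TM.shift]; omega) (by simp only [TM.shift]; omega)
        (by simp only [TM.shift]; intro z h _; simp [show ¬ z < x by omega]))
    · rw [tp_of_mem hx1 hx2]
      simp [machine, trans, hx3]
    · refine tp_eq_update ?_ ?_
      · rw [tp_of_mem hx1 hx2]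
        simp
      · intro z hz _ _
        refine ⟨?_, ?_, ?_⟩ <;> split_ifs <;> first | rfl | omega

end Searcher

/-! ### Words as numbers and the result of the search -/

namespace Searcher

variable {K : ℕ}

/-- Property `(*)` of the word `w 1, …, w N`. -/
def Good (w : ℤ → Fin (K + 1)) (N : ℕ) : Prop :=
  ∀ i j : ℕ, 1 ≤ i → i < j → 2 * j ≤ N → ¬ (blk w i).Sublist (blk w j)

theorem length_seg (w : ℤ → Fin (K + 1)) (p : ℤ) (n : ℕ) : (seg w p n).length = n := by
  induction n generalizing p with
  | zero => rfl
  | succ n ih => simp [seg, ih]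

theorem getElem_seg (w : ℤ → Fin (K + 1)) (p : ℤ) (n t : ℕ) (h : t < (seg w p n).length) :
    (seg w p n)[t] = w (p + t) := by
  induction n generalizing p t with
  | zero => simp [seg] at h
  | succ n ih =>
    cases t with
    | zero => simp [seg]
    | succ t =>
      simp only [seg, List.getElem_cons_succ]
      rw [ih]
      congr 1
      push_cast
      ring

theorem seg_one_isStar_iff (w : ℤ → Fin (K + 1)) (N : ℕ) :
    Friedman.Star (seg w 1 N) ↔ Good w N := by
  have hblock : ∀ i, 1 ≤ i → 2 * i ≤ N → Friedman.block (seg w 1 N) i = blk w i := by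
    intro i hi hN
    unfold Friedman.block blk
    refine List.ext_getElem ?_ fun t h1 h2 => ?_
    · simp only [List.length_take, List.length_drop, length_seg]
      omega
    · simp only [List.getElem_take, List.getElem_drop, getElem_seg]
      congr 1
      omega
  unfold Friedman.Star Good
  simp only [length_seg]
  constructor
  · intro h i j hi hij hj
    rw [← hblock i hi (by omega), ← hblock j (by omega) hj]
    exact h i j hi hij hj
  · intro h i j hi hij hj
    rw [hblock i hi (by omega), hblock j (by omega) hj]
    exact h i j hi hij hj

theorem mem_starLengths_iff {N : ℕ} :
    N ∈ Friedman.starLengths (K + 1) ↔ ∃ w : ℤ → Fin (K + 1), Good w N := by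
  constructor
  · rintro ⟨s, rfl, hs⟩
    refine ⟨fun z => s.getD (z - 1).toNat 0, ?_⟩
    rw [← seg_one_isStar_iff]
    convert hs
    refine List.ext_getElem (length_seg _ _ _) fun t h1 h2 => ?_
    have e : (1 + (t : ℤ) - 1).toNat = t := by omega
    simp only [getElem_seg, e, List.getD_eq_getElem _ _ h2]
  · rintro ⟨w, hw⟩
    exact ⟨_, length_seg w 1 N, (seg_one_isStar_iff w N).2 hw⟩

/-- Property `(*)` passes to prefixes, because a shorter word has fewer blocks to compare. -/
theorem Good.mono {w : ℤ → Fin (K + 1)} {M N : ℕ} (h : Good w N) (hMN : M ≤ N) : Good w M :=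
  fun i j hi hij hj => h i j hi hij (by omega)

theorem Good.congr {w u : ℤ → Fin (K + 1)} {N : ℕ} (h : Good w N)
    (hwu : ∀ z : ℕ, 1 ≤ z → z ≤ N → w z = u z) : Good u N := by
  rw [← seg_one_isStar_iff] at h ⊢
  convert h using 1
  refine List.ext_getElem (by simp [length_seg]) fun t h1 h2 => ?_
  rw [getElem_seg, getElem_seg]
  rw [length_seg] at h1
  have := hwu (1 + t) (by omega) (by omega)
  push_cast at this
  exact this.symm

/-- The number with the digits `w 1, …, w n`. -/
def val (w : ℤ → Fin (K + 1)) : ℕ → ℕ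
  | 0 => 0
  | n + 1 => (K + 1) * val w n + w (n + 1 : ℕ)

theorem val_lt (w : ℤ → Fin (K + 1)) (n : ℕ) : val w n < (K + 1) ^ n := by
  induction n with
  | zero => simp [val]
  | succ n ih =>
    have := (w (n + 1 : ℕ)).2
    rw [val, pow_succ, mul_comm _ (K + 1)]
    nlinarith

theorem val_add_one_of_last {w : ℤ → Fin (K + 1)} {n : ℕ}
    (h : ∀ z : ℤ, 1 ≤ z → z ≤ n → w z = Fin.last K) : val w n + 1 = (K + 1) ^ n := by
  induction n with
  | zero => simp [val]
  | succ n ih =>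
    have := ih fun z h1 h2 => h z h1 (by push_cast; omega)
    rw [val, h (n + 1 : ℕ) (by push_cast; omega) le_rfl, pow_succ, ← this, Fin.val_last]
    ring

theorem eq_of_val_eq {w u : ℤ → Fin (K + 1)} {n : ℕ} (h : val w n = val u n) :
    ∀ z : ℕ, 1 ≤ z → z ≤ n → w z = u z := by
  induction n with
  | zero => intro z; omega
  | succ n ih =>
    have h1 := (w (n + 1 : ℕ)).2
    have h2 := (u (n + 1 : ℕ)).2
    rw [val, val] at h
    have hdiv := congrArg (· / (K + 1)) h
    simp only [Nat.mul_add_div (Nat.succ_pos K), Nat.div_eq_of_lt h1, Nat.div_eq_of_lt h2,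
      add_zero] at hdiv
    intro z hz hzn
    rcases eq_or_lt_of_le hzn with rfl | hlt
    · rw [hdiv] at h
      exact Fin.ext (by omega)
    · exact ih hdiv z hz (by omega)

theorem val_congr {w u : ℤ → Fin (K + 1)} {n : ℕ}
    (h : ∀ z : ℤ, 1 ≤ z → z ≤ n → w z = u z) : val w n = val u n := by
  induction n with
  | zero => rfl
  | succ n ih =>
    rw [val, val, ih fun z h1 h2 => h z h1 (by push_cast; omega),
      h (n + 1 : ℕ) (by push_cast; omega) le_rfl]

/-- The successor of a word is addition of one in base `K + 1`: the carry turns the trailing last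
letters into zeros and stops at `x`. -/
theorem val_next {w : ℤ → Fin (K + 1)} {x : ℤ} {n : ℕ} (hx : 1 ≤ x) (hxn : x ≤ n)
    (hne : w x ≠ Fin.last K) (hlast : ∀ z, x < z → z ≤ n → w z = Fin.last K) :
    val (fun z => if z < x then w z else if z = x then w z + 1 else 0) n = val w n + 1 := by
  induction n with
  | zero => simp at hxn; omega
  | succ n ih =>
    rw [val, val]
    rcases eq_or_lt_of_le hxn with rfl | hlt
    · rw [val_congr (u := w) (n := n) fun z h1 h2 => if_pos (by push_cast; omega)]
      simp only [lt_self_iff_false, if_false, if_true]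
      rw [Fin.val_add_one_of_lt (Fin.lt_last_iff_ne_last.2 hne)]
      ring
    · rw [ih (by push_cast at hlt; omega) fun z h1 h2 => hlast z h1 (by push_cast; omega),
        hlast _ hlt le_rfl]
      simp [show ¬ ((n : ℤ) + 1 < x) by push_cast at hlt; omega,
        show ¬ ((n : ℤ) + 1 = x) by push_cast at hlt; omega]
      ring

/-- From a word such that no earlier word of its length has property `(*)`, the machine arrives at
the word of zeros that is by one longer than the longest word with property `(*)`. -/
theorem reaches_halt (N : ℕ) (w : ℤ → Fin (K + 1)) (hN : N ≤ Friedman.longest (K + 1) + 1)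
    (hw : ∀ u : ℤ → Fin (K + 1), val u N < val w N → ¬ Good u N) :
    ∃ h, (machine K).Reaches ⟨some .growPat, 1, tp N w (fun _ => .out) (fun _ => .out)⟩
      ⟨none, h, tp (Friedman.longest (K + 1) + 1 : ℕ) (fun _ => 0) (fun _ => .out)
        (fun _ => .out)⟩ := by
  rcases reaches_test (w := w) (N := N) (by omega) with ⟨⟨i, j, hi, hij, hj, hs⟩, a, b, hr⟩ | ⟨h, hr⟩
  · have hbad : ¬ Good w N := fun h => h i j hi hij (by omega) hs
    have hbad' : ∀ u : ℤ → Fin (K + 1), val u N = val w N → ¬ Good u N := fun u hu h =>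
      hbad (h.congr (eq_of_val_eq hu))
    rcases reaches_next (w := w) (N := N) (by omega) a b with ⟨h1, h2⟩ | ⟨x, h1, h2, h3, h4, h5⟩
    -- The last word of length `N` is bad, hence all are. If `N` did not exceed the maximum,
    -- truncating a longest good word to length `N` would give a good one.
    · have hNL : N = Friedman.longest (K + 1) + 1 := by
        by_contra hne
        obtain ⟨u, hu⟩ := mem_starLengths_iff.1 (Friedman.isGreatest_longest (K + 1)).1
        have hu := hu.mono (M := N) (by omega)
        have := val_lt u N
        rw [← val_add_one_of_last h1] at this
        rcases eq_or_lt_of_le (Nat.lt_succ_iff.1 this) with h | h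
        · exact hbad' u h hu
        · exact hw u h hu
      rw [← hNL]
      exact ⟨-1, hr.trans h2⟩
    · have hval := val_next h1 h2 h3 h4
      have hlt := val_lt (fun z => if z < x then w z else if z = x then w z + 1 else 0) N
      obtain ⟨h, hh⟩ := reaches_halt N _ hN fun u hu => by
        rw [hval] at hu
        rcases eq_or_lt_of_le (Nat.lt_succ_iff.1 hu) with h | h
        · exact hbad' u h
        · exact hw u h
      exact ⟨h, (hr.trans h5).trans hh⟩
  · have hgood : Good w N := fun i j hi hij hj => h i j hi hij (by omega)
    have hNL : N ≤ Friedman.longest (K + 1) :=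
      (Friedman.isGreatest_longest (K + 1)).2 (mem_starLengths_iff.2 ⟨w, hgood⟩)
    -- The appended digit is `0`, so a word with a smaller number already has a smaller prefix of
    -- length `N`, and this prefix is not good.
    obtain ⟨h, hh⟩ := reaches_halt (N + 1) (Function.update w (N + 1) 0) (by omega) fun u hu hg => by
      have e : val (Function.update w (N + 1) 0) N = val w N := val_congr fun z h1 h2 => by
        rw [Function.update_of_ne (by omega)]
      rw [val, val, e] at hu
      simp only [Nat.cast_add, Nat.cast_one, Function.update_self, Fin.val_zero, add_zero] at hu
      refine hw u ?_ (hg.mono (by omega))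
      exact lt_of_mul_lt_mul_left (by omega) (Nat.zero_le (K + 1))
    rw [Nat.cast_add, Nat.cast_one] at hh
    exact ⟨h, hr.trans hh⟩
-- Either the length grows, up to its bound, or the length stays and the number of the word grows,
-- below `(K + 1) ^ N`.
termination_by (Friedman.longest (K + 1) + 1 - N, (K + 1) ^ N - val w N)
decreasing_by
  · refine Prod.Lex.right _ ?_
    rw [hval] at hlt ⊢
    omega
  · refine Prod.Lex.left _ _ ?_
    omega

/-- The search machine outputs the length of a longest word with property `(*)`. -/
theorem outputs_longest (K : ℕ) : (machine K).Outputs (Friedman.longest (K + 1)) := by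
  obtain ⟨h, hh⟩ := reaches_halt (K := K) 0 (fun _ => 0) (by omega) (fun u hu => by simp [val] at hu)
  have hinit : (machine K).init = ⟨some .clear, 0,
      tp (0 : ℕ) (fun _ => 0) (fun _ => .out) (fun _ => .out)⟩ := by
    unfold Mach.init
    congr 1
    funext z
    rw [tp_of_notMem (by simp; omega)]
    rfl
  have hclear := reaches_clear (K := K) (N := (0 : ℕ)) (w := fun _ => 0) (a := fun _ => .out)
    (b := fun _ => .out) (x := 0) le_rfl (by simp) (fun _ _ _ => ⟨rfl, rfl⟩)
  -- The stroke is the unmarked letter `0`; it fills exactly the cells from `1` to the maximum plus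
  -- one, with blanks on both sides.
  refine ⟨some (0, .out, .out), h, 1, _, by simp [machine], hinit ▸ hclear.trans hh, ?_, ?_, ?_⟩
  · intro j hj
    rw [tp_of_mem (by omega) (by push_cast; omega)]
  · rw [tp_of_notMem (by omega)]
    simp
  · rw [tp_of_notMem (by push_cast; omega)]
    simp

end Searcher

/-! ### Machines with few symbols -/

namespace TM

/-- The machine with the transition table `T`: the entry for the state `q` and the symbol `a` is
`2 * m * s + 2 * e + d`, where `s` is the successor of the new state, or `0` for HALT, `e` is the
symbol written, and `d` is `1` for a move to the right, and `0` for a move to the left. -/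
def ofTable (n m : ℕ) [NeZero n] [NeZero m] (T : List ℕ) (start : Fin n) : TM n m where
  start := start
  blank := 0
  next q a :=
    match T.getD (q * m + a) 0 / (2 * m) with
    | 0 => none
    | s + 1 => some (Fin.ofNat n s)
  write q a := Fin.ofNat m (T.getD (q * m + a) 0 / 2)
  move q a :=
    match T.getD (q * m + a) 0 % 2 with
    | 0 => Turing.Dir.left
    | _ => Turing.Dir.right

/-- The embedding of a configuration in those of a machine with more states and symbols. -/
def Config.castLE {n m n' m' : ℕ} (hn : n ≤ n') (hm : m ≤ m') (c : Config n m) : Config n' m' :=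
  ⟨c.state.map (Fin.castLE hn), c.head, fun z => Fin.castLE hm (c.tape z)⟩

/-- From the embedded initial configuration the added states are never entered and the added symbols
never written, so the transitions chosen for them play no role. -/
theorem ExistsOfSize.mono {n m n' m' v : ℕ} (h : ExistsOfSize n m v) (hn : n ≤ n') (hm : m ≤ m') :
    ExistsOfSize n' m' v := by
  obtain ⟨M, T, -, ⟨hT, -⟩, l, w, p, ⟨i, hi⟩, h1, h2, h3⟩ := h
  let M' : TM n' m' :=
    { start := Fin.castLE hn M.start
      blank := Fin.castLE hm M.blank
      next := fun q a => if h : q.1 < n ∧ a.1 < m then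
        (M.next ⟨q, h.1⟩ ⟨a, h.2⟩).map (Fin.castLE hn) else none
      write := fun q a => if h : q.1 < n ∧ a.1 < m then
        Fin.castLE hm (M.write ⟨q, h.1⟩ ⟨a, h.2⟩) else a
      move := fun q a => if h : q.1 < n ∧ a.1 < m then M.move ⟨q, h.1⟩ ⟨a, h.2⟩
        else Turing.Dir.left }
  have hstep : ∀ c : Config n m, M'.step (c.castLE hn hm) = (M.step c).castLE hn hm := by
    rintro ⟨_ | q, h, t⟩
    · rfl
    · simp only [step, Config.castLE, Option.map_some, M', Fin.val_castLE, Fin.is_lt, and_self,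
        Fin.eta, Config.mk.injEq]
      refine ⟨by simp, by simp, ?_⟩
      funext z
      rcases eq_or_ne z h with rfl | hne
      · simp
      · simp [Function.update_of_ne hne]
  have hrun : ∀ t, M'.run t = (M.run t).castLE hn hm := by
    intro t
    induction t with
    | zero => rfl
    | succ t ih =>
      have e1 : M'.run (t + 1) = M'.step (M'.run t) := Function.iterate_succ_apply' _ _ _
      have e2 : M.run (t + 1) = M.step (M.run t) := Function.iterate_succ_apply' _ _ _
      rw [e1, e2, ih, hstep]
  have hreads : ∀ p, Reads (M'.run T).tape p (Fin.castLE hm ∘ w) ↔ Reads (M.run T).tape p w := by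
    intro p
    refine forall_congr' fun i => ?_
    rw [hrun]
    exact (Fin.castLE_injective hm).eq_iff
  refine ⟨M', M'.computes_of_showsUnary (t := T) ?_ ?_⟩
  · rw [hrun]
    simp [Config.castLE, hT]
  · exact ⟨l, Fin.castLE hm ∘ w, p, ⟨i, fun h => hi (Fin.castLE_injective hm h)⟩,
      fun j hj => (hreads _).2 (h1 j hj), (hreads _).not.2 h2, (hreads _).not.2 h3⟩

end TM

/-! ### Explicit small tables that simulate the search -/

namespace Searcher

variable {K : ℕ}

/-- The direction of the moves into a state. -/
def St.enter : St K → Turing.Dir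
  | .back | .reset | .dropText | .clear | .incr => Turing.Dir.left
  | _ => Turing.Dir.right

/-- A numbering of the states; the states `carry c` get the numbers from `1` on, the others those
in a list. -/
def St.number (l : List ℕ) : St K → ℕ
  | .seek => 0
  | .carry c => 1 + c
  | .back => l.getD 0 0
  | .reset => l.getD 1 0
  | .moveText => l.getD 2 0
  | .growText => l.getD 3 0
  | .growText' => l.getD 4 0
  | .dropText => l.getD 5 0
  | .movePat => l.getD 6 0
  | .growPat => l.getD 7 0
  | .growPat' => l.getD 8 0
  | .clear => l.getD 9 0
  | .incr => l.getD 10 0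

/-- The code of a symbol by two symbols, the first for the letter, and whether it is fresh in the
text, the second for the mark in the pattern, and whether it belongs to the text. -/
def pairCode (m : ℕ) [NeZero m] : Sym K → List (Fin m)
  | none => [0, 0]
  | some (l, a, b) =>
    [Fin.ofNat m (2 * l + match b with | .fresh => 1 | _ => 0),
      Fin.ofNat m ((match a with | .out => 1 | .fresh => 3 | .used => 5) +
        match b with | .out => 0 | _ => 1)]

/-- The code of a symbol over three letters by six bits. -/
def bitCode₃ : Sym 2 → List (Fin 2)
  | none => [0, 0, 0, 0, 0, 0]
  | some (l, a, b) =>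
    (match l with | 0 => [1, 1] | 1 => [1, 0] | 2 => [0, 1]) ++
      (match b with | .out => [0, 0] | .fresh => [1, 1] | .used => [0, 1]) ++
      (match a with | .out => [1, 0] | .fresh => [0, 1] | .used => [1, 1])

/-- The code of a symbol over four letters by six bits. -/
def bitCode₄ : Sym 3 → List (Fin 2)
  | none => [0, 0, 0, 0, 0, 0]
  | some (l, a, b) =>
    (match b with | .out => [1, 0] | .fresh => [1, 1] | .used => [0, 1]) ++
      (match l with | 0 => [0, 0] | 1 => [0, 1] | 2 => [1, 0] | 3 => [1, 1]) ++
      (match a with | .out => [1, 0] | .fresh => [0, 1] | .used => [1, 1])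

/-- The transition table of a machine with 39 states and 7 symbols for words over three letters. -/
def pairTable₃ : List ℕ :=
  [281, 283, 397, 399, 303, 305, 0, 267, 406, 271, 271, 275, 275, 0, 253, 253, 257, 410, 261,
    261, 0, 239, 239, 243, 243, 247, 414, 0, 225, 225, 229, 229, 233, 233, 0, 211, 353, 371, 357,
    375, 361, 0, 197, 408, 203, 412, 207, 416, 0, 183, 185, 187, 189, 191, 193, 0, 169, 311, 329,
    315, 333, 319, 0, 155, 157, 161, 161, 165, 165, 0, 478, 316, 316, 316, 316, 316, 316, 478,
    330, 330, 344, 344, 344, 344, 113, 115, 117, 129, 131, 129, 131, 490, 354, 354, 358, 358, 362,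
    362, 490, 326, 368, 372, 386, 334, 376, 71, 73, 87, 77, 91, 81, 95, 504, 59, 61, 63, 65, 67,
    69, 504, 45, 47, 49, 51, 53, 55, 504, 31, 33, 35, 37, 39, 41, 392, 17, 19, 39, 41, 25, 27, 0,
    17, 19, 67, 69, 25, 27, 422, 422, 149, 426, 135, 430, 135, 339, 149, 149, 135, 135, 135, 135,
    311, 0, 103, 0, 149, 0, 111, 408, 0, 89, 412, 93, 416, 97, 381, 103, 89, 107, 93, 111, 97,
    353, 0, 89, 0, 107, 0, 97, 448, 17, 19, 53, 55, 25, 27, 15, 534, 536, 538, 540, 542, 544, 71,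
    506, 522, 510, 526, 510, 526, 113, 492, 492, 496, 496, 500, 500, 0, 464, 464, 464, 464, 464,
    464, 550, 550, 554, 554, 448, 448, 0, 546, 546, 550, 550, 554, 554, 0, 434, 434, 438, 438,
    442, 442, 0, 420, 0, 424, 0, 428, 0, 0, 422, 422, 426, 426, 430, 430, 0, 406, 408, 410, 412,
    414, 416, 0, 127, 478, 478, 478, 478, 478, 478]

/-- The machine with the table `pairTable₃`. -/
def pairMachine₃ : TM 39 7 := TM.ofTable 39 7 pairTable₃ 38

/-- The numbers of the states of the search machine in `pairMachine₃`. -/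
def pairState₃ : St 2 → Fin 39 := fun q =>
  Fin.ofNat 39 (q.number [28, 29, 4, 5, 6, 30, 7, 8, 9, 38, 31])

/-- A check of 15 states against 28 symbols, each by a run inside one code word; `24` is the fuel
for such a run. -/
theorem pairMachine₃_simulates :
    ∀ q e, (machine 2).LocalStep pairMachine₃ (pairCode 7) St.enter pairState₃ 24 q e := by
  decide +kernel

theorem pairMachine₃_computes : pairMachine₃.Computes (Friedman.longest 3) :=
  (outputs_longest 2).computes_of_localStep (l := 2) (by decide +kernel) (by decide +kernel)
    (by decide +kernel) (by decide +kernel) pairMachine₃_simulates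

/-- The transition table of a machine with 42 states and 9 symbols for words over four letters. -/
def pairTable₄ : List ℕ :=
  [397, 399, 563, 565, 423, 425, 445, 447, 0, 379, 576, 383, 383, 387, 387, 391, 391, 0, 361,
    361, 365, 580, 369, 369, 373, 373, 0, 343, 343, 347, 347, 351, 584, 355, 355, 0, 325, 325,
    329, 329, 333, 333, 337, 588, 0, 307, 307, 311, 311, 315, 315, 319, 319, 0, 289, 507, 529,
    511, 533, 515, 537, 519, 0, 271, 578, 277, 582, 281, 586, 285, 590, 0, 253, 255, 257, 259,
    261, 263, 265, 267, 0, 235, 453, 475, 457, 479, 461, 483, 465, 0, 217, 219, 223, 223, 227,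
    227, 231, 231, 0, 668, 458, 458, 458, 458, 458, 458, 0, 0, 668, 476, 476, 494, 494, 494, 494,
    0, 0, 163, 165, 167, 183, 185, 183, 185, 0, 0, 684, 508, 508, 512, 512, 516, 516, 0, 0, 684,
    472, 526, 530, 548, 480, 534, 0, 0, 109, 111, 129, 115, 133, 119, 137, 0, 0, 702, 93, 95, 97,
    99, 101, 103, 0, 0, 702, 75, 77, 79, 81, 83, 85, 0, 0, 702, 57, 59, 61, 63, 65, 67, 0, 0, 702,
    39, 41, 43, 45, 47, 49, 0, 0, 558, 21, 23, 47, 49, 29, 31, 0, 0, 0, 21, 23, 83, 85, 29, 31, 0,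
    0, 0, 21, 23, 101, 103, 29, 31, 0, 0, 596, 596, 207, 600, 189, 604, 189, 608, 0, 489, 207,
    207, 189, 189, 189, 189, 0, 0, 453, 0, 149, 0, 207, 0, 157, 0, 0, 578, 0, 131, 582, 135, 586,
    139, 590, 0, 543, 149, 131, 153, 135, 157, 139, 0, 0, 507, 0, 131, 0, 153, 0, 139, 0, 0, 630,
    21, 23, 65, 67, 29, 31, 0, 0, 19, 740, 742, 744, 746, 748, 750, 0, 0, 109, 704, 724, 708, 728,
    708, 728, 0, 0, 163, 686, 686, 690, 690, 694, 694, 0, 0, 0, 650, 650, 650, 650, 650, 650, 0,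
    0, 760, 760, 764, 764, 768, 768, 630, 630, 0, 756, 756, 760, 760, 764, 764, 768, 768, 0, 612,
    612, 616, 616, 620, 620, 624, 624, 0, 594, 0, 598, 0, 602, 0, 606, 0, 0, 596, 596, 600, 600,
    604, 604, 608, 608, 0, 576, 578, 580, 582, 584, 586, 588, 590, 0, 181, 668, 668, 668, 668,
    668, 668, 0, 0]

/-- The machine with the table `pairTable₄`. -/
def pairMachine₄ : TM 42 9 := TM.ofTable 42 9 pairTable₄ 41

/-- The numbers of the states of the search machine in `pairMachine₄`. -/
def pairState₄ : St 3 → Fin 42 := fun q =>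
  Fin.ofNat 42 (q.number [31, 32, 5, 6, 7, 33, 8, 9, 10, 41, 34])

theorem pairMachine₄_simulates :
    ∀ q e, (machine 3).LocalStep pairMachine₄ (pairCode 9) St.enter pairState₄ 24 q e := by
  decide +kernel

theorem pairMachine₄_computes : pairMachine₄.Computes (Friedman.longest 4) :=
  (outputs_longest 3).computes_of_localStep (l := 2) (by decide +kernel) (by decide +kernel)
    (by decide +kernel) (by decide +kernel) pairMachine₄_simulates

/-- The transition table of a machine with 124 states and 2 symbols for words over three letters. -/
def bitTable₃ : List ℕ :=
  [281, 287, 253, 259, 225, 231, 197, 203, 161, 167, 129, 135, 113, 119, 69, 75, 41, 47, 339, 51,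
    49, 51, 55, 55, 59, 59, 61, 61, 334, 334, 430, 87, 339, 79, 77, 79, 83, 67, 87, 87, 345, 89,
    39, 35, 97, 99, 105, 107, 185, 33, 109, 111, 103, 103, 448, 123, 121, 123, 127, 127, 458, 458,
    448, 139, 137, 139, 159, 159, 145, 147, 25, 27, 153, 155, 29, 31, 151, 143, 349, 171, 169,
    171, 181, 181, 177, 179, 21, 23, 173, 141, 189, 95, 21, 99, 5, 303, 420, 223, 205, 207, 209,
    209, 213, 215, 217, 219, 17, 19, 209, 460, 420, 239, 233, 239, 241, 460, 241, 241, 245, 247,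
    249, 251, 13, 15, 420, 263, 261, 267, 269, 269, 269, 460, 273, 275, 277, 279, 9, 11, 352, 319,
    289, 295, 309, 311, 297, 195, 301, 303, 279, 307, 5, 7, 313, 315, 251, 307, 321, 355, 325,
    327, 219, 307, 33, 496, 336, 384, 341, 342, 65, 426, 498, 35, 101, 438, 368, 327, 480, 486,
    464, 470, 348, 434, 372, 376, 0, 382, 382, 382, 388, 388, 496, 498, 392, 392, 330, 398, 370,
    335, 329, 410, 410, 410, 412, 412, 416, 416, 384, 386, 360, 362, 420, 422, 428, 346, 436, 438,
    440, 440, 444, 444, 448, 450, 364, 366, 356, 358, 424, 462, 452, 454, 189, 474, 472, 472, 456,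
    478, 426, 426, 193, 490, 488, 490, 492, 494, 460, 462, 400, 404]

/-- The machine with the table `bitTable₃`. -/
def bitMachine₃ : TM 124 2 := TM.ofTable 124 2 bitTable₃ 123

/-- The numbers of the states of the search machine in `bitMachine₃`. -/
def bitState₃ : St 2 → Fin 124 := fun q =>
  Fin.ofNat 124 (q.number [88, 89, 4, 5, 6, 90, 45, 7, 8, 123, 91])

theorem bitMachine₃_simulates :
    ∀ q e, (machine 2).LocalStep bitMachine₃ (bitCode₃) St.enter bitState₃ 24 q e := by
  decide +kernel

theorem bitMachine₃_computes : bitMachine₃.Computes (Friedman.longest 3) :=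
  (outputs_longest 2).computes_of_localStep (l := 6) (by decide +kernel) (by decide +kernel)
    (by decide +kernel) (by decide +kernel) bitMachine₃_simulates

/-- The transition table of a machine with 141 states and 2 symbols for words over four letters. -/
def bitTable₄ : List ℕ :=
  [313, 319, 285, 291, 257, 263, 225, 231, 193, 199, 161, 167, 365, 127, 117, 123, 79, 83, 47,
    51, 69, 55, 55, 55, 57, 59, 61, 63, 65, 65, 454, 454, 73, 93, 353, 39, 69, 87, 87, 87, 89, 91,
    69, 71, 43, 39, 101, 103, 109, 111, 185, 37, 113, 115, 107, 107, 480, 362, 482, 482, 131, 135,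
    149, 151, 137, 139, 141, 143, 145, 147, 29, 31, 153, 155, 157, 159, 33, 35, 369, 488, 169,
    133, 173, 175, 177, 179, 181, 183, 25, 27, 189, 99, 25, 103, 540, 203, 201, 207, 221, 223,
    364, 211, 488, 374, 217, 219, 21, 23, 213, 215, 540, 235, 233, 239, 253, 255, 380, 243, 372,
    546, 249, 251, 17, 19, 245, 247, 540, 267, 265, 271, 273, 275, 381, 386, 277, 279, 281, 283,
    13, 15, 540, 295, 293, 299, 301, 303, 385, 558, 305, 307, 309, 311, 9, 11, 556, 323, 321, 323,
    329, 335, 5, 7, 345, 351, 337, 343, 251, 327, 219, 327, 311, 327, 283, 327, 446, 446, 37, 454,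
    390, 135, 480, 486, 105, 466, 133, 378, 5, 542, 544, 550, 548, 554, 516, 522, 492, 498, 368,
    462, 404, 408, 0, 414, 414, 414, 418, 436, 420, 422, 432, 432, 428, 428, 402, 402, 566, 566,
    422, 424, 357, 446, 416, 418, 356, 358, 456, 394, 448, 450, 464, 466, 468, 470, 472, 474, 476,
    476, 398, 398, 396, 390, 363, 193, 375, 366, 189, 502, 500, 500, 504, 506, 508, 510, 512, 514,
    394, 394, 377, 526, 524, 526, 528, 530, 532, 534, 536, 538, 388, 390, 392, 388, 384, 382, 376,
    225, 556, 257, 400, 562, 0, 285, 440, 352]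

/-- The machine with the table `bitTable₄`. -/
def bitMachine₄ : TM 141 2 := TM.ofTable 141 2 bitTable₄ 140

/-- The numbers of the states of the search machine in `bitMachine₄`. -/
def bitState₄ : St 3 → Fin 141 := fun q =>
  Fin.ofNat 141 (q.number [96, 97, 5, 6, 7, 98, 45, 8, 9, 140, 99])

theorem bitMachine₄_simulates :
    ∀ q e, (machine 3).LocalStep bitMachine₄ (bitCode₄) St.enter bitState₄ 24 q e := by
  decide +kernel

theorem bitMachine₄_computes : bitMachine₄.Computes (Friedman.longest 4) :=
  (outputs_longest 3).computes_of_localStep (l := 6) (by decide +kernel) (by decide +kernel)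
    (by decide +kernel) (by decide +kernel) bitMachine₄_simulates

end Searcher

/-! ### Machines with two states -/

namespace Mach

variable {Q S : Type} {n m : ℕ}

/-- The machine with its states and symbols numbered. -/
def toTM (M : Mach Q S) (eQ : Q ≃ Fin n) (eS : S ≃ Fin m) : TM n m where
  start := eQ M.start
  blank := eS M.blank
  next q a := (M.trans (eQ.symm q) (eS.symm a)).1.map eQ
  write q a := eS (M.trans (eQ.symm q) (eS.symm a)).2.1
  move q a := (M.trans (eQ.symm q) (eS.symm a)).2.2

theorem run_toTM (M : Mach Q S) (eQ : Q ≃ Fin n) (eS : S ≃ Fin m) (t : ℕ) :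
    (M.toTM eQ eS).run t = ⟨(M.step^[t] M.init).state.map eQ, (M.step^[t] M.init).head,
      fun z => eS ((M.step^[t] M.init).tape z)⟩ := by
  induction t with
  | zero => rfl
  | succ t ih =>
    have e : (M.toTM eQ eS).run (t + 1) = (M.toTM eQ eS).step ((M.toTM eQ eS).run t) :=
      Function.iterate_succ_apply' _ _ _
    rw [e, ih, Function.iterate_succ_apply']
    obtain ⟨_ | q, h, tape⟩ := M.step^[t] M.init
    · rfl
    · simp only [TM.step, step, Option.map_some, toTM, Equiv.symm_apply_apply, TM.Config.mk.injEq,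
        true_and]
      funext z
      rcases eq_or_ne z h with rfl | hne
      · simp
      · simp [Function.update_of_ne hne]

end Mach

namespace TwoState

instance : Fintype Turing.Dir := ⟨{.left, .right}, by rintro (_ | _) <;> simp⟩

/-- The opposite direction. -/
def opp : Turing.Dir → Turing.Dir
  | .left => .right
  | .right => .left

/-- A symbol of the machine with two states: a symbol of the simulated machine, alone, or with a
counter, the direction of the move for which the counter stands, and a flag that tells the cell
which the head leaves from the one which it enters. -/
abbrev Cell (m r : ℕ) := Fin m ⊕ (Bool × Turing.Dir × Fin r × Fin m)

variable {n m r : ℕ}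

/-- A cell without a counter. -/
abbrev plain (a : Fin m) : Cell m r := Sum.inl a

/-- The cell which the head leaves. -/
abbrev sender (d : Turing.Dir) (k : Fin r) (a : Fin m) : Cell m r := Sum.inr (true, d, k, a)

/-- The cell which the head enters. -/
abbrev receiver (d : Turing.Dir) (k : Fin r) (a : Fin m) : Cell m r := Sum.inr (false, d, k, a)

/-- The state in which the head first enters a cell. -/
def arrival : Turing.Dir → Bool
  | .right => false
  | .left => true

/-- The transitions. A state of `M` entered by a move in the direction `d` is a counter `k`, by
`dec d k`. It is passed on from cell to cell in unary, the head going to and fro. In the cell that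
receives, the state `false` stands for one unit, and the state `true` for the end. -/
def trans (M : TM n m) [NeZero r] (dec : Turing.Dir → Fin r → Fin n)
    (enc : Turing.Dir → Fin n → Fin r) : Bool → Cell m r → Option Bool × Cell m r × Turing.Dir
  | false, Sum.inl a => (some true, receiver .right 0 a, .left)
  | true, Sum.inl a => (some false, receiver .left 0 a, .right)
  | _, Sum.inr (true, d, k, a) =>
    if k.1 = 0 then (some true, plain a, d)
    else (some false, sender d ⟨k - 1, by omega⟩ a, d)
  | false, Sum.inr (false, d, k, a) =>
    if h : k + 1 < r then (some false, receiver d ⟨k + 1, h⟩ a, opp d)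
    else (some true, plain a, opp d)
  | true, Sum.inr (false, d, k, a) =>
    match M.next (dec d k) a, M.write (dec d k) a, M.move (dec d k) a with
    | none, b, d' => (none, plain b, d')
    | some q, b, d' => (some (arrival d'), sender d' (enc d' q) b, d')

/-- The machine with two states that simulates `M`. -/
def machine (M : TM n m) [NeZero r] (dec : Turing.Dir → Fin r → Fin n)
    (enc : Turing.Dir → Fin n → Fin r) : Mach Bool (Cell m r) where
  start := false
  blank := plain M.blank
  trans := trans M dec enc

variable (M : TM n m) [NeZero r] (dec : Turing.Dir → Fin r → Fin n)
  (enc : Turing.Dir → Fin n → Fin r)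

/-- The tape on which the cells `x` and `y` are `s` and `t`, and the others are plain. -/
def tape₂ (T : ℤ → Fin m) (x : ℤ) (s : Cell m r) (y : ℤ) (t : Cell m r) : ℤ → Cell m r :=
  fun z => if z = x then s else if z = y then t else plain (T z)

theorem reaches_step_fst {T : ℤ → Fin m} {x y : ℤ} {s s' t : Cell m r} {q : Bool}
    {q' : Option Bool} {d : Turing.Dir} (h : trans M dec enc q s = (q', s', d)) :
    (machine M dec enc).Reaches ⟨some q, x, tape₂ T x s y t⟩
      ⟨q', x + TM.shift d, tape₂ T x s' y t⟩ := by
  refine (machine M dec enc).reaches_step (e := s') ?_ ?_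
  · simpa [tape₂, machine] using h
  · funext z
    rcases eq_or_ne z x with rfl | hne
    · simp [tape₂]
    · simp [tape₂, hne]

theorem reaches_step_snd {T : ℤ → Fin m} {x y : ℤ} {s t t' : Cell m r} {q : Bool}
    {q' : Option Bool} {d : Turing.Dir} (hxy : y ≠ x) (h : trans M dec enc q t = (q', t', d)) :
    (machine M dec enc).Reaches ⟨some q, y, tape₂ T x s y t⟩
      ⟨q', y + TM.shift d, tape₂ T x s y t'⟩ := by
  refine (machine M dec enc).reaches_step (e := t') ?_ ?_
  · simpa [tape₂, machine, hxy] using h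
  · funext z
    rcases eq_or_ne z y with rfl | hne
    · simp [tape₂, hxy]
    · simp [tape₂, hne]

theorem shift_opp (d : Turing.Dir) : TM.shift (opp d) = - TM.shift d := by cases d <;> rfl

theorem shift_ne_zero (d : Turing.Dir) : TM.shift d ≠ 0 := by cases d <;> simp [TM.shift]

/-- The sender gives up one unit, the receiver adds it and returns the head, so the sum of the
counters is invariant. The sender ignores the state in which it is entered. Once it is empty it
sends the head off in state `true`, which tells the receiver to act. -/
theorem reaches_transfer {T : ℤ → Fin m} {x : ℤ} {a b : Fin m} {d : Turing.Dir} (k : ℕ) {j : ℕ}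
    (hk : k + j < r) (q : Bool) :
    (machine M dec enc).Reaches
      ⟨some q, x, tape₂ T x (sender d ⟨k, by omega⟩ a) (x + TM.shift d)
        (receiver d ⟨j, by omega⟩ b)⟩
      ⟨some true, x + TM.shift d, tape₂ T x (plain a) (x + TM.shift d)
        (receiver d ⟨k + j, hk⟩ b)⟩ := by
  induction k generalizing j q with
  | zero =>
    simp only [zero_add]
    exact reaches_step_fst M dec enc (by cases q <;> simp [trans])
  | succ k ih =>
    have h1 := reaches_step_fst M dec enc (T := T) (x := x) (y := x + TM.shift d)
      (s := sender d ⟨k + 1, by omega⟩ a) (s' := sender d ⟨k, by omega⟩ a)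
      (t := receiver d ⟨j, by omega⟩ b) (q := q) (q' := some false) (d := d)
      (by cases q <;> simp [trans])
    have h2 := reaches_step_snd M dec enc (T := T) (x := x) (y := x + TM.shift d)
      (s := sender d ⟨k, by omega⟩ a) (t := receiver d ⟨j, by omega⟩ b)
      (t' := receiver d ⟨j + 1, by omega⟩ b) (q := false) (q' := some false) (d := opp d)
      (by have := shift_ne_zero d; omega) (by simp [trans, show j + 1 < r by omega])
    rw [shift_opp, add_neg_cancel_right] at h2
    have h3 := ih (j := j + 1) (by omega) false
    have e : k + (j + 1) = k + 1 + j := by ring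
    simp only [e] at h3
    exact (h1.trans h2).trans h3

/-- The tape when `M` is about to act on the cell `x`. -/
def tape₁ (T : ℤ → Fin m) (x : ℤ) (d : Turing.Dir) (k : Fin r) : ℤ → Cell m r :=
  fun z => if z = x then receiver d k (T z) else plain (T z)

/-- The acting cell becomes a sender whose counter codes the new state. The state `arrival` tells
the plain neighbour from which side the head came, so it can become a receiver and send the head
back to fetch the units. -/
theorem reaches_next (hdec : ∀ q a, ∀ q' ∈ M.next q a,
      dec (M.move q a) (enc (M.move q a) q') = q') {T : ℤ → Fin m} {x : ℤ} {d : Turing.Dir}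
    {k : Fin r} {q q' : Fin n} (hq : dec d k = q) (hn : M.next q (T x) = some q') :
    ∃ k', dec (M.move q (T x)) k' = q' ∧ (machine M dec enc).Reaches ⟨some true, x, tape₁ T x d k⟩
      ⟨some true, x + TM.shift (M.move q (T x)),
        tape₁ (Function.update T x (M.write q (T x))) (x + TM.shift (M.move q (T x)))
          (M.move q (T x)) k'⟩ := by
  subst hq
  refine ⟨enc (M.move (dec d k) (T x)) q', hdec _ _ _ hn, ?_⟩
  generalize hd : M.move (dec d k) (T x) = d'
  generalize hw : M.write (dec d k) (T x) = b
  have hne : x + TM.shift d' ≠ x := by have := shift_ne_zero d'; omega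
  have e1 : tape₁ (r := r) T x d k =
      tape₂ T x (receiver d k (T x)) (x + TM.shift d') (plain (T (x + TM.shift d'))) := by
    funext z
    simp only [tape₁, tape₂]
    split_ifs with h1 h2
    · rw [h1]
    · rw [h2]
    · rfl
  rw [e1]
  have h1 := reaches_step_fst M dec enc (T := T) (x := x) (y := x + TM.shift d')
      (s := receiver d k (T x)) (s' := sender d' (enc d' q') b)
      (t := plain (T (x + TM.shift d'))) (q := true) (q' := some (arrival d')) (d := d')
      (by simp [trans, hn, hd, hw])
  have h2 := reaches_step_snd M dec enc (T := T) (x := x) (y := x + TM.shift d')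
      (s := sender d' (enc d' q') b) (t := plain (T (x + TM.shift d')))
      (t' := receiver d' 0 (T (x + TM.shift d'))) (q := arrival d') (q' := some (! arrival d'))
      (d := opp d') hne (by cases d' <;> rfl)
  rw [shift_opp, add_neg_cancel_right] at h2
  have h3 := reaches_transfer M dec enc (T := T) (x := x) (a := b) (b := T (x + TM.shift d'))
    (d := d') (enc d' q') (j := 0) (by simp) (! arrival d')
  refine (h1.trans (h2.trans h3)).trans ?_
  have e2 : tape₂ T x (plain b) (x + TM.shift d')
      (receiver d' ⟨enc d' q' + 0, by simp⟩ (T (x + TM.shift d'))) =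
      tape₁ (Function.update T x b) (x + TM.shift d') d' (enc d' q') := by
    funext z
    simp only [tape₁, tape₂, Function.update_apply]
    split_ifs with h1 h2 h2
    · exact absurd (h2.symm.trans h1) hne
    · rfl
    · simp [h2]
    · rfl
  rw [e2]
  exact Mach.Reaches.refl _ _

/-- On a blank tape the two states cannot announce a start state: cells `0` and `-1` take each other
for senders and count up together. Cell `0` overflows first and releases cell `-1` with the maximal
counter, so `r - 1` has to code the start state for moves to the left. -/
theorem reaches_start : (machine M dec enc).Reaches (machine M dec enc).init
    ⟨some true, -1, tape₁ (fun _ => M.blank) (-1) .left ⟨r - 1, by have := NeZero.pos r; omega⟩⟩ := by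
  have hr := NeZero.pos r
  have h1 := reaches_step_fst M dec enc (T := fun _ => M.blank) (x := 0) (y := -1)
      (s := plain M.blank) (s' := receiver .right 0 M.blank)
      (t := plain M.blank) (q := false) (q' := some true) (d := .left) rfl
  have h2 := reaches_step_snd M dec enc (T := fun _ => M.blank) (x := 0) (y := -1)
      (s := receiver .right 0 M.blank) (t := plain M.blank)
      (t' := receiver .left 0 M.blank) (q := true) (q' := some false) (d := .right)
      (by norm_num) rfl
  -- Here `j` is the number of rounds left before the counter in cell `0` overflows.
  have h3 : ∀ j k, (hk : k < r) → k + j + 1 = r → (machine M dec enc).Reaches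
      ⟨some false, 0, tape₂ (fun _ => M.blank) 0 (receiver .right ⟨k, hk⟩ M.blank) (-1)
        (receiver .left ⟨k, hk⟩ M.blank)⟩
      ⟨some true, -1, tape₂ (fun _ => M.blank) 0 (plain M.blank) (-1)
        (receiver .left ⟨r - 1, by omega⟩ M.blank)⟩ := by
    intro j
    induction j with
    | zero =>
      intro k hk hkr
      obtain rfl : k = r - 1 := by omega
      exact reaches_step_fst M dec enc (d := .left) (q' := some true)
        (by simp [trans, show ¬ r - 1 + 1 < r by omega, opp])
    | succ j ih =>
      intro k hk hkr
      have i1 := reaches_step_fst M dec enc (T := fun _ => M.blank) (x := 0) (y := -1)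
        (s := receiver .right ⟨k, hk⟩ M.blank)
        (s' := receiver .right ⟨k + 1, by omega⟩ M.blank)
        (t := receiver .left ⟨k, hk⟩ M.blank) (q := false) (q' := some false) (d := .left)
        (by simp [trans, show k + 1 < r by omega, opp])
      have i2 := reaches_step_snd M dec enc (T := fun _ => M.blank) (x := 0) (y := -1)
        (s := receiver .right ⟨k + 1, by omega⟩ M.blank)
        (t := receiver .left ⟨k, hk⟩ M.blank)
        (t' := receiver .left ⟨k + 1, by omega⟩ M.blank) (q := false) (q' := some false)
        (d := .right) (by norm_num) (by simp [trans, show k + 1 < r by omega, opp])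
      exact (Mach.Reaches.trans i1 i2).trans (ih (k + 1) (by omega) (by omega))
  have h4 := (Mach.Reaches.trans h1 h2).trans (h3 (r - 1) 0 hr (by omega))
  have e1 : (machine M dec enc).init = ⟨some false, 0, tape₂ (fun _ => M.blank) 0
      (plain M.blank) (-1) (plain M.blank)⟩ := by
    unfold Mach.init
    congr 1
    funext z
    simp [tape₂, machine]
  have e2 : tape₁ (r := r) (fun _ => M.blank) (-1) .left ⟨r - 1, by omega⟩ = tape₂ (fun _ => M.blank) 0
      (plain M.blank) (-1) (receiver .left ⟨r - 1, by omega⟩ M.blank) := by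
    funext z
    simp only [tape₁, tape₂]
    split_ifs <;> first | rfl | omega
  rw [e1, e2]
  exact h4

/-- If the states of `M`, by the direction of the move into them, are coded by `r` numbers, then a
machine with two states computes what `M` computes. -/
theorem existsOfSize_two {v : ℕ} (hM : M.Computes v)
    (hdec : ∀ q a, ∀ q' ∈ M.next q a, dec (M.move q a) (enc (M.move q a) q') = q')
    (hstart : ∀ k : Fin r, k + 1 = r → dec .left k = M.start) :
    TM.ExistsOfSize 2 (4 * r * m + m) v := by
  obtain ⟨T, -, ⟨hT, -⟩, l, w, p, ⟨i, hi⟩, h1, h2, h3⟩ := hM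
  have hr := NeZero.pos r
  -- Everything is displaced by one cell to the left, since the start-up phase ends on cell `-1`.
  have key : ∀ t, ∃ c, (machine M dec enc).Reaches (machine M dec enc).init c ∧
      ((M.run t).state = none ∧ c.state = none ∧ (∀ z, c.tape (z - 1) = plain ((M.run t).tape z)) ∨
      ∃ d k, (M.run t).state = some (dec d k) ∧ c = ⟨some true, (M.run t).head - 1,
        tape₁ (fun z => (M.run t).tape (z + 1)) ((M.run t).head - 1) d k⟩) := by
    intro t
    induction t with
    | zero =>
      refine ⟨_, reaches_start M dec enc, Or.inr ⟨.left, ⟨r - 1, by omega⟩, ?_, ?_⟩⟩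
      · rw [hstart _ (by simp; omega)]
        rfl
      · simp [TM.run, TM.init]
    | succ t ih =>
      have e : M.run (t + 1) = M.step (M.run t) := Function.iterate_succ_apply' _ _ _
      rw [e]
      obtain ⟨c, hc, ⟨k1, k2, k3⟩ | ⟨d, k, k1, rfl⟩⟩ := ih
      · refine ⟨c, hc, Or.inl ?_⟩
        rw [show M.step (M.run t) = M.run t by simp [TM.step, k1]]
        exact ⟨k1, k2, k3⟩
      · generalize M.run t = c at k1 hc
        obtain ⟨s, x, tp⟩ := c
        obtain rfl : s = some (dec d k) := k1
        have ha : tp (x - 1 + 1) = tp x := by rw [sub_add_cancel]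
        cases hn : M.next (dec d k) (tp x) with
        | none =>
          refine ⟨⟨none, x - 1 + TM.shift (M.move (dec d k) (tp x)), fun z =>
            plain (Function.update tp x (M.write (dec d k) (tp x)) (z + 1))⟩, hc.trans
            ((machine M dec enc).reaches_step (e := plain (M.write (dec d k) (tp x)))
              (d := M.move (dec d k) (tp x)) ?_ ?_), Or.inl ⟨?_, rfl, ?_⟩⟩
          · simp [machine, tape₁, trans, hn]
          · funext z
            rcases eq_or_ne z (x - 1) with rfl | hne
            · simp
            · rw [Function.update_of_ne hne, Function.update_of_ne (by omega)]
              simp [tape₁, hne]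
          · simp [TM.step, hn]
          · simp [TM.step]
        | some q' =>
          obtain ⟨k', i1, i2⟩ := reaches_next M dec enc hdec (T := fun z => tp (z + 1)) (x := x - 1)
            (d := d) (k := k) (q := dec d k) (q' := q') rfl (by simpa using hn)
          simp only [ha] at i1 i2
          refine ⟨_, hc.trans i2, Or.inr ⟨M.move (dec d k) (tp x), k', ?_, ?_⟩⟩
          · simp [TM.step, hn, i1]
          · have e1 : x - 1 + TM.shift (M.move (dec d k) (tp x)) =
                x + TM.shift (M.move (dec d k) (tp x)) - 1 := by ring
            simp only [TM.step, e1]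
            congr 2
            funext z
            rcases eq_or_ne z (x - 1) with rfl | hne
            · simp
            · rw [Function.update_of_ne hne, Function.update_of_ne (by omega)]
  obtain ⟨c, ⟨t, ht⟩, ⟨-, k2, k3⟩ | ⟨d, k, k1, -⟩⟩ := key T
  swap
  · rw [hT] at k1
    simp at k1
  have hcard : Fintype.card (Cell m r) = 4 * r * m + m := by
    have : Fintype.card Turing.Dir = 2 := rfl
    simp [this]
    ring
  let eS := Fintype.equivFinOfCardEq hcard
  let M' := (machine M dec enc).toTM (Fintype.equivFinOfCardEq Fintype.card_bool) eS
  have hreads : ∀ z, TM.Reads (M'.run t).tape (z - 1) (fun i => eS (plain (w i))) ↔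
      TM.Reads (M.run T).tape z w := by
    intro z
    refine forall_congr' fun i => ?_
    rw [Mach.run_toTM, ht]
    simp only [EmbeddingLike.apply_eq_iff_eq]
    rw [show z - 1 + ((i : ℕ) : ℤ) = z + (i : ℕ) - 1 by ring, k3]
    exact Sum.inl_injective.eq_iff
  refine ⟨M', M'.computes_of_showsUnary (t := t) ?_ ⟨l, fun i => eS (plain (w i)), p - 1, ⟨i, ?_⟩,
    fun j hj => ?_, ?_, ?_⟩⟩
  · rw [Mach.run_toTM, ht]
    simp [k2]
  · exact fun h => hi (Sum.inl_injective (eS.injective h))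
  · rw [show p - 1 + l * (j : ℤ) = p + l * j - 1 by ring, hreads]
    exact h1 j hj
  · rw [show p - 1 - (l : ℤ) = p - l - 1 by ring, hreads]
    exact h2
  · rw [show p - 1 + (l : ℤ) * (v + 1) = p + l * (v + 1) - 1 by ring, hreads]
    exact h3

end TwoState

/-! ### The two-state machines for three and four letters -/

namespace TwoState

/-- The state of number `k` among those entered by a move in a given direction: of `n` states, those
entered by a move to the right are among the first `r`, the others among the last `r`. -/
def stateOf (n r : ℕ) [NeZero n] : Turing.Dir → Fin r → Fin n
  | .right, k => Fin.ofNat n k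
  | .left, k => Fin.ofNat n (k + (n - r))

/-- The number of a state among those entered by a move in a given direction. -/
def numberOf (n r : ℕ) [NeZero r] : Turing.Dir → Fin n → Fin r
  | .right, q => Fin.ofNat r q
  | .left, q => Fin.ofNat r (q - (n - r))

/-- The size is `706 = 4 * 88 * 2 + 2`. The ranges of 88 numbers for the two directions overlap in
the states 36 to 87, and the start state 123 is the last one, as the start-up requires. With `r =
96`, four letters give `770` in the same way. -/
theorem existsOfSize_longest_three : TM.ExistsOfSize 2 706 (Friedman.longest 3) :=
  existsOfSize_two Searcher.bitMachine₃ (stateOf 124 88) (numberOf 124 88)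
    Searcher.bitMachine₃_computes (by decide +kernel) (by decide +kernel)

theorem existsOfSize_longest_four : TM.ExistsOfSize 2 770 (Friedman.longest 4) :=
  existsOfSize_two Searcher.bitMachine₄ (stateOf 141 96) (numberOf 141 96)
    Searcher.bitMachine₄_computes (by decide +kernel) (by decide +kernel)

end TwoState

theorem mainTheorem1 :
    -- the machines for `n(3)`
    (TM.ExistsOfSize 2 1840 (Friedman.longest 3) ∧
      TM.ExistsOfSize 3 1080 (Friedman.longest 3) ∧
      TM.ExistsOfSize 9 800 (Friedman.longest 3) ∧
      TM.ExistsOfSize 44 8 (Friedman.longest 3) ∧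
      TM.ExistsOfSize 54 7 (Friedman.longest 3) ∧
      TM.ExistsOfSize 155 3 (Friedman.longest 3) ∧
      TM.ExistsOfSize 276 2 (Friedman.longest 3)) ∧
    -- the machines for `n(4)`
    (TM.ExistsOfSize 2 2450 (Friedman.longest 4) ∧
      TM.ExistsOfSize 3 1440 (Friedman.longest 4) ∧
      TM.ExistsOfSize 9 1030 (Friedman.longest 4) ∧
      TM.ExistsOfSize 47 10 (Friedman.longest 4) ∧
      TM.ExistsOfSize 58 9 (Friedman.longest 4) ∧
      TM.ExistsOfSize 160 4 (Friedman.longest 4) ∧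
      TM.ExistsOfSize 353 3 (Friedman.longest 4) ∧
      TM.ExistsOfSize 922 2 (Friedman.longest 4)) := by
  have few₃ := TwoState.existsOfSize_longest_three
  have few₄ := TwoState.existsOfSize_longest_four
  have pair₃ : TM.ExistsOfSize 39 7 (Friedman.longest 3) := ⟨_, Searcher.pairMachine₃_computes⟩
  have pair₄ : TM.ExistsOfSize 42 9 (Friedman.longest 4) := ⟨_, Searcher.pairMachine₄_computes⟩
  have bit₃ : TM.ExistsOfSize 124 2 (Friedman.longest 3) := ⟨_, Searcher.bitMachine₃_computes⟩
  have bit₄ : TM.ExistsOfSize 141 2 (Friedman.longest 4) := ⟨_, Searcher.bitMachine₄_computes⟩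
  -- For each alphabet three machines dominate all the sizes: the two-state one those with 2, 3 and
  -- 9 states, the pair-coded one the next two, and the binary one the rest.
  refine ⟨⟨few₃.mono ?_ ?_, few₃.mono ?_ ?_, few₃.mono ?_ ?_, pair₃.mono ?_ ?_, pair₃.mono ?_ ?_,
    bit₃.mono ?_ ?_, bit₃.mono ?_ ?_⟩, few₄.mono ?_ ?_, few₄.mono ?_ ?_, few₄.mono ?_ ?_,
    pair₄.mono ?_ ?_, pair₄.mono ?_ ?_, bit₄.mono ?_ ?_, bit₄.mono ?_ ?_, bit₄.mono ?_ ?_⟩ <;>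
  norm_num
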